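/- We work in affine continuous logic. Nonlogical symbols are constant symbols, function symbols and relation symbols; each function or relation symbol carries an arity $n\ge 1$ and a Lipschitz constant $\lambda\ge 0$. A Lipschitz language $L$ is a set of such symbols (of arbitrary cardinality). The metric symbol $d$ is a logical symbol, available in every language. $L$-terms are built from variables and constant symbols with function symbols; $L$-formulas are built from the atomic formulas $1$, $d(t_1,t_2)$ and $R(t_1,\dots,t_n)$ by $\phi+\psi$, $r\phi$ ($r\in\mathbb R$), $\inf_x\phi$ and $\sup_x\phi$; a sentence is a formula without free variables. An $L$-structure is a nonempty complete metric space $(M,d)$ of diameter at most $1$ with an element $c^M\in M$ for each constant symbol $c\in L$, a map $F^M:M^n\to M$ with $d(F^M(\bar a),F^M(\bar b))\le\lambda_F\sum_i d(a_i,b_i)$ for each $n$-ary function symbol $F\in L$, and a map $R^M:M^n\to[0,1]$ with $R^M(\bar a)-R^M(\bar b)\le\lambda_R\sum_i d(a_i,b_i)$ for each $n$-ary relation symbol $R\in L$. The real value $\sigma^M$ of an $L$-sentence $\sigma$ in $M$ is defined inductively in the obvious way, with $\inf_x$ and $\sup_x$ interpreted as infimum and supremum over $M$. A theory in $L$ is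 a set $T$ of closed conditions $\sigma\le\eta$, where $\sigma,\eta$ are $L$-sentences. An $L$-structure $M$ is a model of $T$ if $\sigma^M\le\eta^M$ for every condition $\sigma\le\eta$ in $T$. $T$ is satisfiable in $L$ if it has a model that is an $L$-structure. $T$ is complete in $L$ if it is satisfiable in $L$ and for every $L$-sentence $\sigma$ there is $r\in\mathbb R$ such that $\sigma^M=r$ for every $L$-structure $M$ that is a model of $T$. **Theorem (Affine Robinson's consistency).** Let $L_1$ and $L_2$ be Lipschitz languages, and let $T_1$ and $T_2$ be theories in $L_1$ and $L_2$ that are satisfiable in $L_1$ and $L_2$ respectively. Assume that $T_1\cap T_2$ (the set of conditions that belong to both) is complete in $L_1\cap L_2$. Then $T_1\cup T_2$ is satisfiable in $L_1\cup L_2$. -/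

import Mathlib

open scoped NNReal

universe u

namespace AffineLogic

/-- A stock of nonlogical symbols: constant symbols, function symbols and relation symbols.
Each function or relation symbol carries its arity `n ≥ 1` and its Lipschitz constant `≥ 0`.
The metric symbol `d` is a logical symbol and is not listed here. -/
structure Symbols where
  Const : Type u
  Func : Type u
  Rel : Type u
  funcArity : Func → ℕ
  funcArity_pos : ∀ F, 0 < funcArity F
  funcLip : Func → ℝ≥0
  relArity : Rel → ℕ
  relArity_pos : ∀ R, 0 < relArity R
  relLip : Rel → ℝ≥0

/-- A Lipschitz language: a set of symbols. -/
structure Language (S : Symbols.{u}) where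
  consts : Set S.Const
  funcs : Set S.Func
  rels : Set S.Rel

variable {S : Symbols.{u}}

instance : Inter (Language S) where
  inter L₁ L₂ := ⟨L₁.consts ∩ L₂.consts, L₁.funcs ∩ L₂.funcs, L₁.rels ∩ L₂.rels⟩

instance : Union (Language S) where
  union L₁ L₂ := ⟨L₁.consts ∪ L₂.consts, L₁.funcs ∪ L₂.funcs, L₁.rels ∪ L₂.rels⟩

/-- Terms; the individual variables are indexed by `ℕ`. -/
inductive Term (S : Symbols.{u}) : Type u
  | var (x : ℕ) : Term S
  | const (c : S.Const) : Term S
  | func (F : S.Func) (ts : Fin (S.funcArity F) → Term S) : Term S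

/-- Formulas of affine continuous logic, built from `1`, `d(t₁, t₂)` and `R(t₁, …, tₙ)` by
addition, multiplication by real numbers, and the quantifiers `inf` and `sup`. -/
inductive Formula (S : Symbols.{u}) : Type u
  | one : Formula S
  | dist (t₁ t₂ : Term S) : Formula S
  | rel (R : S.Rel) (ts : Fin (S.relArity R) → Term S) : Formula S
  | add (φ ψ : Formula S) : Formula S
  | smul (r : ℝ) (φ : Formula S) : Formula S
  | inf (x : ℕ) (φ : Formula S) : Formula S
  | sup (x : ℕ) (φ : Formula S) : Formula S

/-- `t.In L`: `t` is an `L`-term, that is, all its symbols belong to `L`. -/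
def Term.In (L : Language S) : Term S → Prop
  | .var _ => True
  | .const c => c ∈ L.consts
  | .func F ts => F ∈ L.funcs ∧ ∀ i, (ts i).In L

/-- `φ.In L`: `φ` is an `L`-formula, that is, all its nonlogical symbols belong to `L`. -/
def Formula.In (L : Language S) : Formula S → Prop
  | .one => True
  | .dist t₁ t₂ => t₁.In L ∧ t₂.In L
  | .rel R ts => R ∈ L.rels ∧ ∀ i, (ts i).In L
  | .add φ ψ => φ.In L ∧ ψ.In L
  | .smul _ φ => φ.In L
  | .inf _ φ => φ.In L
  | .sup _ φ => φ.In L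

/-- The variables that occur in a term. -/
def Term.vars : Term S → Set ℕ
  | .var x => {x}
  | .const _ => ∅
  | .func _ ts => ⋃ i, (ts i).vars

/-- The free variables of a formula. -/
def Formula.freeVars : Formula S → Set ℕ
  | .one => ∅
  | .dist t₁ t₂ => t₁.vars ∪ t₂.vars
  | .rel _ ts => ⋃ i, (ts i).vars
  | .add φ ψ => φ.freeVars ∪ ψ.freeVars
  | .smul _ φ => φ.freeVars
  | .inf x φ => φ.freeVars \ {x}
  | .sup x φ => φ.freeVars \ {x}

/-- A sentence is a formula without free variables. -/
def Formula.IsSentence (φ : Formula S) : Prop := φ.freeVars = ∅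

/-- An `L`-structure: a nonempty complete metric space of diameter at most `1` with
interpretations of the symbols of `L` that respect the Lipschitz constants, where `Mⁿ` carries
the metric `∑ i, d(xᵢ, yᵢ)`; relations take values in `[0, 1]`. -/
structure LStructure (L : Language S) where
  carrier : Type u
  [nonempty : Nonempty carrier]
  [metric : MetricSpace carrier]
  [complete : CompleteSpace carrier]
  dist_le_one : ∀ a b : carrier, Dist.dist a b ≤ 1
  const : L.consts → carrier
  func : (F : L.funcs) → (Fin (S.funcArity F) → carrier) → carrier
  func_lipschitz : ∀ (F : L.funcs) (a b : Fin (S.funcArity F) → carrier),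
    Dist.dist (func F a) (func F b) ≤ S.funcLip F * ∑ i, Dist.dist (a i) (b i)
  rel : (R : L.rels) → (Fin (S.relArity R) → carrier) → ℝ
  rel_mem : ∀ (R : L.rels) (a : Fin (S.relArity R) → carrier), rel R a ∈ Set.Icc (0 : ℝ) 1
  rel_lipschitz : ∀ (R : L.rels) (a b : Fin (S.relArity R) → carrier),
    rel R a - rel R b ≤ S.relLip R * ∑ i, Dist.dist (a i) (b i)

attribute [instance] LStructure.nonempty LStructure.metric LStructure.complete

/-- The value of an `L`-term in an `L`-structure under an assignment of the variables. -/
def Term.eval {L : Language S} (M : LStructure L) (v : ℕ → M.carrier) :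
    (t : Term S) → t.In L → M.carrier
  | .var x, _ => v x
  | .const c, h => M.const ⟨c, h⟩
  | .func F ts, h => M.func ⟨F, h.1⟩ fun i => (ts i).eval M v (h.2 i)

/-- The value of an `L`-formula in an `L`-structure under an assignment of the variables. The
infima and suprema are over nonempty bounded sets of real numbers. -/
noncomputable def Formula.eval {L : Language S} (M : LStructure L) :
    (φ : Formula S) → φ.In L → (ℕ → M.carrier) → ℝ
  | .one, _, _ => 1
  | .dist t₁ t₂, h, v => Dist.dist (t₁.eval M v h.1) (t₂.eval M v h.2)
  | .rel R ts, h, v => M.rel ⟨R, h.1⟩ fun i => (ts i).eval M v (h.2 i)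
  | .add φ ψ, h, v => φ.eval M h.1 v + ψ.eval M h.2 v
  | .smul r φ, h, v => r * φ.eval M h v
  | .inf x φ, h, v => ⨅ b : M.carrier, φ.eval M h (Function.update v x b)
  | .sup x φ, h, v => ⨆ b : M.carrier, φ.eval M h (Function.update v x b)

/-- A condition `φ ≤ ψ`. -/
structure Condition (S : Symbols.{u}) where
  lhs : Formula S
  rhs : Formula S

/-- `c.In L`: both sides of the condition are `L`-formulas. -/
def Condition.In (L : Language S) (c : Condition S) : Prop := c.lhs.In L ∧ c.rhs.In L

/-- A condition is closed if both sides are sentences. -/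
def Condition.IsClosed (c : Condition S) : Prop := c.lhs.IsSentence ∧ c.rhs.IsSentence

/-- `T` is a theory in `L`: a set of closed conditions between `L`-sentences. -/
def IsTheory (L : Language S) (T : Set (Condition S)) : Prop :=
  ∀ c ∈ T, c.In L ∧ c.IsClosed

/-- `M ⊨ φ ≤ ψ`, for `φ ≤ ψ` a condition in `L`. The values of sentences do not depend on the
assignment `v`. -/
def LStructure.Models {L : Language S} (M : LStructure L) (c : Condition S) : Prop :=
  ∃ h : c.In L, ∀ v : ℕ → M.carrier, c.lhs.eval M h.1 v ≤ c.rhs.eval M h.2 v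

/-- `M ⊨ T`. -/
def LStructure.ModelsTheory {L : Language S} (M : LStructure L) (T : Set (Condition S)) : Prop :=
  ∀ c ∈ T, M.Models c

/-- `T` is satisfiable in `L`: some `L`-structure is a model of `T`. -/
def Satisfiable (L : Language S) (T : Set (Condition S)) : Prop :=
  ∃ M : LStructure L, M.ModelsTheory T

/-- `T ⊨ φ ≤ ψ`, with respect to `L`-structures. -/
def Entails (L : Language S) (T : Set (Condition S)) (c : Condition S) : Prop :=
  ∀ M : LStructure L, M.ModelsTheory T → M.Models c

/-- The real number `r` as a sentence, namely `r · 1`. -/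
def Formula.real (r : ℝ) : Formula S := .smul r .one

/-- `T` is complete in `L`: it is satisfiable and decides the value of every `L`-sentence, that is,
for every `L`-sentence `σ` there is a real number `r` such that `T ⊨ σ = r`. -/
def IsComplete (L : Language S) (T : Set (Condition S)) : Prop :=
  Satisfiable L T ∧
    ∀ σ : Formula S, σ.In L → σ.IsSentence →
      ∃ r : ℝ, Entails L T ⟨σ, Formula.real r⟩ ∧ Entails L T ⟨Formula.real r, σ⟩

end AffineLogic

/-! Take models M of T₁ and N of T₂. Completeness of T₁ ∩ T₂ makes every sentence of the common
language L₁ ∩ L₂ take the same value in both. It then suffices to find elementary extensions of M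
and N that are isomorphic over the common language: transporting the symbols outside L₁ across the
isomorphism gives one structure for both theories.

The tool is the power of a structure by a finitely additive probability measure, the affine
substitute for an ultrapower. Quantifiers commute with the integral because near-optimal witnesses
can be chosen pointwise, so the value of a formula in the power is the integral of its values
(`val_meanPower`), and M sits elementarily in the power as the constant functions.

To absorb N, index the power by the maps i from N to M that respect a given correspondence, and ask
for a mean under which φ(i(b)) integrates to φ(b). By the Riesz extension theorem such a mean exists
as soon as the prescribed functional is positive (`Mean.exists_extension`). Linear combinations of
affine formulas are again formulas, so positivity concerns a single formula, and it follows by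
taking the infimum over the points that have no partner (`IsPartialElementary.nonneg`). The outcome
is `IsPartialElementary.exists_amalgam`.

Alternating this between the two sides (`Pair.exists_next`) gives two elementary chains whose unions
are isomorphic over L₁ ∩ L₂ up to distance zero. The construction takes place in pseudometric
structures interpreting all symbols; `exists_completion` returns to complete metric spaces. -/

namespace AffineLogic

variable {S : Symbols.{u}}

/-! ### Pseudometric structures and values of formulas -/

/-- An interpretation of all the symbols of `S` on a space with a pseudometric `d` of diameter at
most `1`. -/
structure PreStructure (S : Symbols.{u}) where
  carrier : Type u
  [nonempty : Nonempty carrier]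
  d : carrier → carrier → ℝ
  d_self : ∀ a, d a a = 0
  d_comm : ∀ a b, d a b = d b a
  d_triangle : ∀ a b c, d a c ≤ d a b + d b c
  d_le_one : ∀ a b, d a b ≤ 1
  const : S.Const → carrier
  func : (F : S.Func) → (Fin (S.funcArity F) → carrier) → carrier
  func_lipschitz : ∀ (F : S.Func) (a b : Fin (S.funcArity F) → carrier),
    d (func F a) (func F b) ≤ S.funcLip F * ∑ i, d (a i) (b i)
  rel : (R : S.Rel) → (Fin (S.relArity R) → carrier) → ℝ
  rel_mem : ∀ (R : S.Rel) (a : Fin (S.relArity R) → carrier), rel R a ∈ Set.Icc (0 : ℝ) 1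
  rel_lipschitz : ∀ (R : S.Rel) (a b : Fin (S.relArity R) → carrier),
    rel R a - rel R b ≤ S.relLip R * ∑ i, d (a i) (b i)

attribute [instance] PreStructure.nonempty

namespace PreStructure

theorem d_nonneg (P : PreStructure S) (a b : P.carrier) : 0 ≤ P.d a b := by
  have h := P.d_triangle a b a
  rw [P.d_self, P.d_comm b a] at h
  linarith

theorem abs_d_sub_d_le (P : PreStructure S) (a b a' b' : P.carrier) :
    |P.d a b - P.d a' b'| ≤ P.d a a' + P.d b b' := by
  rw [abs_le]
  constructor
  · linarith [P.d_triangle a' a b', P.d_triangle a b b', P.d_comm a a']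
  · linarith [P.d_triangle a a' b, P.d_triangle a' b' b, P.d_comm b b']

theorem abs_rel_sub_rel_le (P : PreStructure S) (R : S.Rel)
    (a b : Fin (S.relArity R) → P.carrier) :
    |P.rel R a - P.rel R b| ≤ S.relLip R * ∑ i, P.d (a i) (b i) := by
  rw [abs_le]
  constructor
  · have h := P.rel_lipschitz R b a
    simp only [P.d_comm (b _)] at h
    linarith
  · exact P.rel_lipschitz R a b

/-- Points at distance zero can be replaced by each other. -/
theorem d_congr (P : PreStructure S) {a b a' b' : P.carrier} (h : P.d a a' = 0)
    (h' : P.d b b' = 0) : P.d a b = P.d a' b' := by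
  have := P.abs_d_sub_d_le a b a' b'
  rw [h, h', add_zero] at this
  linarith [abs_nonpos_iff.1 this]

theorem d_zero_trans (P : PreStructure S) {a b c : P.carrier} (h : P.d a b = 0)
    (h' : P.d b c = 0) : P.d a c = 0 := by
  linarith [P.d_triangle a b c, P.d_nonneg a c]

theorem func_congr (P : PreStructure S) (F : S.Func) {a b : Fin (S.funcArity F) → P.carrier}
    (h : ∀ i, P.d (a i) (b i) = 0) : P.d (P.func F a) (P.func F b) = 0 := by
  have := P.func_lipschitz F a b
  simp only [h, Finset.sum_const_zero, mul_zero] at this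
  exact le_antisymm this (P.d_nonneg _ _)

theorem rel_congr (P : PreStructure S) (R : S.Rel) {a b : Fin (S.relArity R) → P.carrier}
    (h : ∀ i, P.d (a i) (b i) = 0) : P.rel R a = P.rel R b := by
  have := P.abs_rel_sub_rel_le R a b
  simp only [h, Finset.sum_const_zero, mul_zero] at this
  linarith [abs_nonpos_iff.1 this]

/-- The value of a term. -/
def tval (P : PreStructure S) (v : ℕ → P.carrier) : Term S → P.carrier
  | .var x => v x
  | .const c => P.const c
  | .func F ts => P.func F fun i => P.tval v (ts i)

/-- The value of a formula. -/
noncomputable def val (P : PreStructure S) : Formula S → (ℕ → P.carrier) → ℝ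
  | .one, _ => 1
  | .dist t₁ t₂, v => P.d (P.tval v t₁) (P.tval v t₂)
  | .rel R ts, v => P.rel R fun i => P.tval v (ts i)
  | .add φ ψ, v => P.val φ v + P.val ψ v
  | .smul r φ, v => r * P.val φ v
  | .inf x φ, v => ⨅ b : P.carrier, P.val φ (Function.update v x b)
  | .sup x φ, v => ⨆ b : P.carrier, P.val φ (Function.update v x b)

/-! ### Boundedness and Lipschitz dependence on the assignment -/

/-- The values of a formula are bounded, uniformly in the structure. -/
theorem exists_abs_val_le (φ : Formula S) :
    ∃ C : ℝ, 0 ≤ C ∧ ∀ (P : PreStructure S) v, |P.val φ v| ≤ C := by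
  induction φ with
  | one => exact ⟨1, zero_le_one, fun P v => by simp [val]⟩
  | dist t₁ t₂ =>
    refine ⟨1, zero_le_one, fun P v => ?_⟩
    rw [val, abs_of_nonneg (P.d_nonneg _ _)]
    exact P.d_le_one _ _
  | rel R ts =>
    refine ⟨1, zero_le_one, fun P v => ?_⟩
    have h := P.rel_mem R fun i => P.tval v (ts i)
    rw [val, abs_of_nonneg h.1]
    exact h.2
  | add φ ψ hφ hψ =>
    obtain ⟨C, hC, h⟩ := hφ
    obtain ⟨D, hD, h'⟩ := hψ
    exact ⟨C + D, by positivity, fun P v => (abs_add_le _ _).trans (add_le_add (h P v) (h' P v))⟩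
  | smul r φ hφ =>
    obtain ⟨C, hC, h⟩ := hφ
    refine ⟨|r| * C, by positivity, fun P v => ?_⟩
    rw [val, abs_mul]
    exact mul_le_mul_of_nonneg_left (h P v) (abs_nonneg r)
  | inf x φ hφ =>
    obtain ⟨C, hC, h⟩ := hφ
    refine ⟨C, hC, fun P v => abs_le.2 ⟨le_ciInf fun b => (abs_le.1 (h P _)).1, ?_⟩⟩
    exact (ciInf_le ⟨-C, by rintro _ ⟨b, rfl⟩; exact (abs_le.1 (h P _)).1⟩
      (Classical.arbitrary P.carrier)).trans (abs_le.1 (h P _)).2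
  | sup x φ hφ =>
    obtain ⟨C, hC, h⟩ := hφ
    refine ⟨C, hC, fun P v => abs_le.2 ⟨?_, ciSup_le fun b => (abs_le.1 (h P _)).2⟩⟩
    exact (abs_le.1 (h P _)).1.trans
      (le_ciSup (f := fun b => P.val φ (Function.update v x b))
        ⟨C, by rintro _ ⟨b, rfl⟩; exact (abs_le.1 (h P _)).2⟩ (Classical.arbitrary P.carrier))

theorem bddBelow_val (P : PreStructure S) (φ : Formula S) {ι : Type*} (w : ι → ℕ → P.carrier) :
    BddBelow (Set.range fun b => P.val φ (w b)) := by
  obtain ⟨C, -, h⟩ := exists_abs_val_le φ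
  exact ⟨-C, by rintro _ ⟨b, rfl⟩; exact (abs_le.1 (h P _)).1⟩

theorem bddAbove_val (P : PreStructure S) (φ : Formula S) {ι : Type*} (w : ι → ℕ → P.carrier) :
    BddAbove (Set.range fun b => P.val φ (w b)) := by
  obtain ⟨C, -, h⟩ := exists_abs_val_le φ
  exact ⟨C, by rintro _ ⟨b, rfl⟩; exact (abs_le.1 (h P _)).2⟩

theorem val_inf_le (P : PreStructure S) (x : ℕ) (φ : Formula S) (v : ℕ → P.carrier)
    (b : P.carrier) : P.val (.inf x φ) v ≤ P.val φ (Function.update v x b) :=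
  ciInf_le (P.bddBelow_val φ fun b => Function.update v x b) b

theorem le_val_sup (P : PreStructure S) (x : ℕ) (φ : Formula S) (v : ℕ → P.carrier)
    (b : P.carrier) : P.val φ (Function.update v x b) ≤ P.val (.sup x φ) v :=
  le_ciSup (P.bddAbove_val φ fun b => Function.update v x b) b

theorem exists_d_tval_le (P : PreStructure S) (t : Term S) :
    ∃ C : ℝ, 0 ≤ C ∧ ∀ v w δ, 0 ≤ δ → (∀ x ∈ t.vars, P.d (v x) (w x) ≤ δ) →
      P.d (P.tval v t) (P.tval w t) ≤ C * δ := by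
  induction t with
  | var x => exact ⟨1, zero_le_one, fun v w δ _ h => by simpa [tval] using h x rfl⟩
  | const c => exact ⟨0, le_rfl, fun v w δ _ h => by simp [tval, P.d_self]⟩
  | func F ts ih =>
    choose C hC h using ih
    refine ⟨S.funcLip F * ∑ i, C i,
      mul_nonneg (NNReal.coe_nonneg _) (Finset.sum_nonneg fun i _ => hC i), fun v w δ hδ hv => ?_⟩
    refine (P.func_lipschitz F _ _).trans ?_
    rw [mul_assoc, Finset.sum_mul]
    refine mul_le_mul_of_nonneg_left (Finset.sum_le_sum fun i _ => ?_) (NNReal.coe_nonneg _)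
    exact h i v w δ hδ fun x hx => hv x (Set.mem_iUnion.2 ⟨i, hx⟩)

theorem abs_ciInf_sub_ciInf_le {ι : Type*} [Nonempty ι] {f g : ι → ℝ} {c : ℝ}
    (hf : BddBelow (Set.range f)) (hg : BddBelow (Set.range g)) (h : ∀ i, |f i - g i| ≤ c) :
    |(⨅ i, f i) - ⨅ i, g i| ≤ c := by
  have h1 : (⨅ i, f i) - c ≤ ⨅ i, g i :=
    le_ciInf fun i => by linarith [ciInf_le hf i, (abs_le.1 (h i)).2]
  have h2 : (⨅ i, g i) - c ≤ ⨅ i, f i :=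
    le_ciInf fun i => by linarith [ciInf_le hg i, (abs_le.1 (h i)).1]
  rw [abs_le]
  constructor <;> linarith

theorem abs_ciSup_sub_ciSup_le {ι : Type*} [Nonempty ι] {f g : ι → ℝ} {c : ℝ}
    (hf : BddAbove (Set.range f)) (hg : BddAbove (Set.range g)) (h : ∀ i, |f i - g i| ≤ c) :
    |(⨆ i, f i) - ⨆ i, g i| ≤ c := by
  have h1 : (⨆ i, f i) ≤ (⨆ i, g i) + c :=
    ciSup_le fun i => by linarith [le_ciSup hg i, (abs_le.1 (h i)).2]
  have h2 : (⨆ i, g i) ≤ (⨆ i, f i) + c :=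
    ciSup_le fun i => by linarith [le_ciSup hf i, (abs_le.1 (h i)).1]
  rw [abs_le]
  constructor <;> linarith

/-- This carries the Lipschitz bound through a quantifier: the bound variable receives the same
value on both sides and contributes distance zero. -/
theorem d_update_le (P : PreStructure S) {A : Set ℕ} {x : ℕ} {v w : ℕ → P.carrier} {δ : ℝ}
    (hδ : 0 ≤ δ) (h : ∀ y ∈ A \ {x}, P.d (v y) (w y) ≤ δ) (b : P.carrier) :
    ∀ y ∈ A, P.d (Function.update v x b y) (Function.update w x b y) ≤ δ := by
  intro y hy
  by_cases hyx : y = x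
  · subst hyx
    simpa [P.d_self] using hδ
  · simpa [hyx] using h y ⟨hy, hyx⟩

/-- Formulas are Lipschitz in the values of their free variables. -/
theorem exists_abs_val_sub_val_le (P : PreStructure S) (φ : Formula S) :
    ∃ C : ℝ, 0 ≤ C ∧ ∀ v w δ, 0 ≤ δ → (∀ x ∈ φ.freeVars, P.d (v x) (w x) ≤ δ) →
      |P.val φ v - P.val φ w| ≤ C * δ := by
  induction φ with
  | one => exact ⟨0, le_rfl, fun v w δ _ _ => by simp [val]⟩
  | dist t₁ t₂ =>
    obtain ⟨C, hC, h⟩ := P.exists_d_tval_le t₁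
    obtain ⟨D, hD, h'⟩ := P.exists_d_tval_le t₂
    refine ⟨C + D, by positivity, fun v w δ hδ hv => (P.abs_d_sub_d_le _ _ _ _).trans ?_⟩
    rw [add_mul]
    exact add_le_add (h v w δ hδ fun x hx => hv x (Or.inl hx))
      (h' v w δ hδ fun x hx => hv x (Or.inr hx))
  | rel R ts =>
    choose C hC h using fun i => P.exists_d_tval_le (ts i)
    refine ⟨S.relLip R * ∑ i, C i,
      mul_nonneg (NNReal.coe_nonneg _) (Finset.sum_nonneg fun i _ => hC i), fun v w δ hδ hv => ?_⟩
    refine (P.abs_rel_sub_rel_le R _ _).trans ?_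
    rw [mul_assoc, Finset.sum_mul]
    refine mul_le_mul_of_nonneg_left (Finset.sum_le_sum fun i _ => ?_) (NNReal.coe_nonneg _)
    exact h i v w δ hδ fun x hx => hv x (Set.mem_iUnion.2 ⟨i, hx⟩)
  | add φ ψ hφ hψ =>
    obtain ⟨C, hC, h⟩ := hφ
    obtain ⟨D, hD, h'⟩ := hψ
    refine ⟨C + D, by positivity, fun v w δ hδ hv => ?_⟩
    rw [add_mul, val, val, add_sub_add_comm]
    exact (abs_add_le _ _).trans (add_le_add (h v w δ hδ fun x hx => hv x (Or.inl hx))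
      (h' v w δ hδ fun x hx => hv x (Or.inr hx)))
  | smul r φ hφ =>
    obtain ⟨C, hC, h⟩ := hφ
    refine ⟨|r| * C, by positivity, fun v w δ hδ hv => ?_⟩
    rw [val, val, ← mul_sub, abs_mul, mul_assoc]
    exact mul_le_mul_of_nonneg_left (h v w δ hδ hv) (abs_nonneg r)
  | inf x φ hφ =>
    obtain ⟨C, hC, h⟩ := hφ
    exact ⟨C, hC, fun v w δ hδ hv => abs_ciInf_sub_ciInf_le (P.bddBelow_val _ _)
      (P.bddBelow_val _ _) fun b => h _ _ δ hδ (P.d_update_le hδ hv b)⟩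
  | sup x φ hφ =>
    obtain ⟨C, hC, h⟩ := hφ
    exact ⟨C, hC, fun v w δ hδ hv => abs_ciSup_sub_ciSup_le (P.bddAbove_val _ _)
      (P.bddAbove_val _ _) fun b => h _ _ δ hδ (P.d_update_le hδ hv b)⟩

/-- The Lipschitz bound with δ = 0. Because of it, all later identities between points are needed
only up to distance zero, and no quotient has to be formed along the way. -/
theorem val_congr_d (P : PreStructure S) (φ : Formula S) {v w : ℕ → P.carrier}
    (h : ∀ x ∈ φ.freeVars, P.d (v x) (w x) = 0) : P.val φ v = P.val φ w := by
  obtain ⟨C, hC, hφ⟩ := P.exists_abs_val_sub_val_le φ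
  have := hφ v w 0 le_rfl fun x hx => (h x hx).le
  rw [mul_zero] at this
  linarith [abs_nonpos_iff.1 this]

theorem val_congr (P : PreStructure S) (φ : Formula S) {v w : ℕ → P.carrier}
    (h : ∀ x ∈ φ.freeVars, v x = w x) : P.val φ v = P.val φ w :=
  P.val_congr_d φ fun x hx => by rw [h x hx, P.d_self]

theorem val_sentence (P : PreStructure S) {φ : Formula S} (h : φ.IsSentence)
    (v w : ℕ → P.carrier) : P.val φ v = P.val φ w :=
  P.val_congr φ fun x hx => by rw [h] at hx; exact hx.elim

end PreStructure

/-! ### Free variables, renaming and blocks of infima -/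

theorem Term.finite_vars (t : Term S) : t.vars.Finite := by
  induction t with
  | var x => exact Set.finite_singleton x
  | const c => exact Set.finite_empty
  | func F ts ih => exact Set.finite_iUnion ih

theorem Formula.finite_freeVars (φ : Formula S) : φ.freeVars.Finite := by
  induction φ with
  | one => exact Set.finite_empty
  | dist t₁ t₂ => exact t₁.finite_vars.union t₂.finite_vars
  | rel R ts => exact Set.finite_iUnion fun i => (ts i).finite_vars
  | add φ ψ hφ hψ => exact hφ.union hψ
  | smul r φ h => exact h
  | inf x φ h => exact h.sdiff
  | sup x φ h => exact h.sdiff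

/-- Renaming of variables in a term. -/
def Term.rename (ρ : ℕ → ℕ) : Term S → Term S
  | .var x => .var (ρ x)
  | .const c => .const c
  | .func F ts => .func F fun i => (ts i).rename ρ

theorem Term.vars_rename (ρ : ℕ → ℕ) (t : Term S) : (t.rename ρ).vars = ρ '' t.vars := by
  induction t with
  | var x => simp [Term.rename, Term.vars]
  | const c => simp [Term.rename, Term.vars]
  | func F ts ih => simp [Term.rename, Term.vars, Set.image_iUnion, ih]

theorem Term.in_rename {L : Language S} (ρ : ℕ → ℕ) (t : Term S) (h : t.In L) :
    (t.rename ρ).In L := by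
  induction t with
  | var x => trivial
  | const c => exact h
  | func F ts ih => exact ⟨h.1, fun i => ih i (h.2 i)⟩

theorem PreStructure.tval_rename (P : PreStructure S) (ρ : ℕ → ℕ) (v : ℕ → P.carrier)
    (t : Term S) : P.tval v (t.rename ρ) = P.tval (v ∘ ρ) t := by
  induction t with
  | var x => rfl
  | const c => rfl
  | func F ts ih => simp [Term.rename, tval, ih]

theorem exists_fresh (A : Set ℕ) (hA : A.Finite) (ρ : ℕ → ℕ) : ∃ y, ∀ z ∈ A, ρ z ≠ y := by
  obtain ⟨y, hy⟩ := (hA.image ρ).infinite_compl.nonempty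
  exact ⟨y, fun z hz h => hy ⟨z, hz, h⟩⟩

/-- Freshness of `y` means that no free variable other than `x` is renamed to `y`, so changing the
value at `y` affects only `x`. -/
theorem PreStructure.val_update_comp_update (P : PreStructure S) (φ : Formula S) {ρ : ℕ → ℕ}
    {x y : ℕ} (hy : ∀ z ∈ φ.freeVars \ {x}, ρ z ≠ y) (v : ℕ → P.carrier) (b : P.carrier) :
    P.val φ (Function.update v y b ∘ Function.update ρ x y) =
      P.val φ (Function.update (v ∘ ρ) x b) := by
  refine P.val_congr φ fun z hz => ?_
  by_cases hzx : z = x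
  · subst hzx; simp
  · simp [hzx, hy z ⟨hz, hzx⟩]

theorem freeVars_rename_diff {A B : Set ℕ} {ρ : ℕ → ℕ} {x y : ℕ}
    (h : B ⊆ Function.update ρ x y '' A) : B \ {y} ⊆ ρ '' (A \ {x}) := by
  rintro z ⟨hz, hzy⟩
  obtain ⟨a, ha, rfl⟩ := h hz
  have hax : a ≠ x := by
    rintro rfl
    simp at hzy
  exact ⟨a, ⟨ha, hax⟩, by simp [hax]⟩

/-- Capture-avoiding renaming of the free variables of a formula. -/
theorem Formula.exists_rename {L : Language S} (φ : Formula S) (hφ : φ.In L) (ρ : ℕ → ℕ) :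
    ∃ ψ : Formula S, ψ.In L ∧ ψ.freeVars ⊆ ρ '' φ.freeVars ∧
      ∀ (P : PreStructure S) v, P.val ψ v = P.val φ (v ∘ ρ) := by
  induction φ generalizing ρ with
  | one => exact ⟨.one, trivial, by simp [Formula.freeVars], fun P v => rfl⟩
  | dist t₁ t₂ =>
    refine ⟨.dist (t₁.rename ρ) (t₂.rename ρ), ⟨t₁.in_rename ρ hφ.1, t₂.in_rename ρ hφ.2⟩, ?_,
      fun P v => by simp [PreStructure.val, P.tval_rename]⟩
    simp [Formula.freeVars, Term.vars_rename, Set.image_union]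
  | rel R ts =>
    refine ⟨.rel R fun i => (ts i).rename ρ, ⟨hφ.1, fun i => (ts i).in_rename ρ (hφ.2 i)⟩, ?_,
      fun P v => by simp [PreStructure.val, P.tval_rename]⟩
    simp [Formula.freeVars, Term.vars_rename, Set.image_iUnion]
  | add φ₁ φ₂ h₁ h₂ =>
    obtain ⟨ψ₁, i₁, f₁, e₁⟩ := h₁ hφ.1 ρ
    obtain ⟨ψ₂, i₂, f₂, e₂⟩ := h₂ hφ.2 ρ
    refine ⟨.add ψ₁ ψ₂, ⟨i₁, i₂⟩, ?_, fun P v => by simp [PreStructure.val, e₁, e₂]⟩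
    simp only [Formula.freeVars, Set.image_union]
    exact Set.union_subset_union f₁ f₂
  | smul r φ h =>
    obtain ⟨ψ, i, f, e⟩ := h hφ ρ
    exact ⟨.smul r ψ, i, f, fun P v => by simp [PreStructure.val, e]⟩
  | inf x φ h =>
    obtain ⟨y, hy⟩ := exists_fresh (φ.freeVars \ {x}) φ.finite_freeVars.sdiff ρ
    obtain ⟨ψ, i, f, e⟩ := h hφ (Function.update ρ x y)
    exact ⟨.inf y ψ, i, freeVars_rename_diff f, fun P v => by
      simp only [PreStructure.val, e, P.val_update_comp_update φ hy]⟩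
  | sup x φ h =>
    obtain ⟨y, hy⟩ := exists_fresh (φ.freeVars \ {x}) φ.finite_freeVars.sdiff ρ
    obtain ⟨ψ, i, f, e⟩ := h hφ (Function.update ρ x y)
    exact ⟨.sup y ψ, i, freeVars_rename_diff f, fun P v => by
      simp only [PreStructure.val, e, P.val_update_comp_update φ hy]⟩

/-- The infimum over the values of finitely many variables. -/
theorem Formula.exists_inf {L : Language S} (φ : Formula S) (hφ : φ.In L) (s : Finset ℕ) :
    ∃ ψ : Formula S, ψ.In L ∧ ψ.freeVars ⊆ φ.freeVars \ s ∧
      (∀ (P : PreStructure S) v, P.val ψ v ≤ P.val φ v) ∧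
      ∀ (P : PreStructure S) v r, (∀ w, (∀ x ∉ s, w x = v x) → r ≤ P.val φ w) → r ≤ P.val ψ v := by
  induction s using Finset.induction_on with
  | empty =>
    exact ⟨φ, hφ, by simp, fun _ _ => le_rfl, fun P v r h => h v fun _ _ => rfl⟩
  | insert x s hx ih =>
    obtain ⟨ψ, i, f, h1, h2⟩ := ih
    refine ⟨.inf x ψ, i, ?_, fun P v => ?_, fun P v r h => le_ciInf fun b => h2 P _ r ?_⟩
    · rintro y ⟨hy, hyx⟩
      exact ⟨(f hy).1, by simpa using ⟨hyx, (f hy).2⟩⟩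
    · refine (P.val_inf_le x ψ v (v x)).trans ?_
      rw [Function.update_eq_self]
      exact h1 P v
    · intro w hw
      refine h w fun y hy => ?_
      rw [Finset.mem_insert, not_or] at hy
      rw [hw y hy.2, Function.update_of_ne hy.1]

/-! ### Means and extension of positive functionals -/

/-- Boundedness of a real function. -/
def IsBdd {I : Type*} (f : I → ℝ) : Prop := ∃ C : ℝ, ∀ i, |f i| ≤ C

namespace IsBdd

variable {I : Type*} {f g : I → ℝ}

theorem const (r : ℝ) : IsBdd fun _ : I => r := ⟨|r|, fun _ => le_rfl⟩

theorem add (hf : IsBdd f) (hg : IsBdd g) : IsBdd fun i => f i + g i := by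
  obtain ⟨C, hC⟩ := hf
  obtain ⟨D, hD⟩ := hg
  exact ⟨C + D, fun i => (abs_add_le _ _).trans (add_le_add (hC i) (hD i))⟩

theorem smul (r : ℝ) (hf : IsBdd f) : IsBdd fun i => r * f i := by
  obtain ⟨C, hC⟩ := hf
  exact ⟨|r| * C, fun i => by
    rw [abs_mul]; exact mul_le_mul_of_nonneg_left (hC i) (abs_nonneg r)⟩

theorem sum {ι : Type*} (s : Finset ι) {f : ι → I → ℝ} (hf : ∀ j, IsBdd (f j)) :
    IsBdd fun i => ∑ j ∈ s, f j i := by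
  classical
  induction s using Finset.induction_on with
  | empty => simpa using const 0
  | insert j s hj ih => simpa only [Finset.sum_insert hj] using (hf j).add ih

end IsBdd

/-- A mean on `I`: a finitely additive probability measure on all the subsets of `I`, presented as
the integral of bounded functions. -/
structure Mean (I : Type*) where
  toFun : (I → ℝ) → ℝ
  mono : ∀ {f g}, IsBdd f → IsBdd g → (∀ i, f i ≤ g i) → toFun f ≤ toFun g
  add : ∀ {f g}, IsBdd f → IsBdd g → toFun (fun i => f i + g i) = toFun f + toFun g
  smul : ∀ (r : ℝ) {f}, IsBdd f → toFun (fun i => r * f i) = r * toFun f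
  one : toFun (fun _ => 1) = 1

namespace Mean

variable {I : Type*}

theorem const (μ : Mean I) (r : ℝ) : μ.toFun (fun _ => r) = r := by
  simpa [μ.one] using μ.smul r (IsBdd.const (I := I) 1)

theorem add_const (μ : Mean I) {f : I → ℝ} (hf : IsBdd f) (r : ℝ) :
    μ.toFun (fun i => f i + r) = μ.toFun f + r := by
  rw [μ.add hf (IsBdd.const r), μ.const]

theorem sum (μ : Mean I) {ι : Type*} (s : Finset ι) {f : ι → I → ℝ} (hf : ∀ j, IsBdd (f j)) :
    μ.toFun (fun i => ∑ j ∈ s, f j i) = ∑ j ∈ s, μ.toFun (f j) := by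
  classical
  induction s using Finset.induction_on with
  | empty => simpa using μ.const 0
  | insert j s hj ih =>
    simp only [Finset.sum_insert hj]
    rw [μ.add (hf j) (IsBdd.sum s hf), ih]

/-- A positive normalised functional on a family of bounded functions extends to a mean. -/
theorem exists_extension {X : Type*} (g : X → I → ℝ) (hg : ∀ x, IsBdd (g x)) (c : X → ℝ)
    (pos : ∀ p : X →₀ ℝ, (∀ i, 0 ≤ p.sum fun x r => r * g x i) → 0 ≤ p.sum fun x r => r * c x)
    (x₀ : X) (hg₀ : ∀ i, g x₀ i = 1) (hc₀ : c x₀ = 1) :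
    ∃ μ : Mean I, ∀ x, μ.toFun (g x) = c x := by
  let E : Submodule ℝ (I → ℝ) :=
    { carrier := {f | IsBdd f}
      add_mem' := fun hf hg => hf.add hg
      zero_mem' := IsBdd.const 0
      smul_mem' := fun r _ hf => hf.smul r }
  let A : (X →₀ ℝ) →ₗ[ℝ] E := Finsupp.linearCombination ℝ fun x => (⟨g x, hg x⟩ : E)
  let B : (X →₀ ℝ) →ₗ[ℝ] ℝ := Finsupp.linearCombination ℝ c
  have hA : ∀ p i, (A p : I → ℝ) i = p.sum fun x r => r * g x i := by
    intro p i
    have : (A p : I → ℝ) i = ((LinearMap.proj i).comp E.subtype) (A p) := rfl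
    rw [this, Finsupp.linearCombination_apply, map_finsuppSum]
    rfl
  have hB : ∀ p, B p = p.sum fun x r => r * c x := fun p => Finsupp.linearCombination_apply ℝ p
  have hAB : ∀ p, (∀ i, 0 ≤ (A p : I → ℝ) i) → 0 ≤ B p := by
    intro p hp
    rw [hB]
    exact pos p fun i => by rw [← hA]; exact hp i
  -- If a combination vanishes on `I`, then it and its negative are both nonnegative there, so its
  -- prescribed value is zero. Hence the prescription descends to the range of `A`.
  have hker : LinearMap.ker A ≤ LinearMap.ker B := by
    intro p hp
    rw [LinearMap.mem_ker] at hp ⊢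
    refine le_antisymm ?_ (hAB p fun i => by rw [hp]; exact le_rfl)
    have := hAB (-p) fun i => by rw [map_neg, hp, neg_zero]; exact le_rfl
    rw [map_neg] at this
    linarith
  let f : E →ₗ.[ℝ] ℝ :=
    ⟨LinearMap.range A, ((LinearMap.ker A).liftQ B hker).comp A.quotKerEquivRange.symm.toLinearMap⟩
  have hf : ∀ p, f ⟨A p, LinearMap.mem_range_self A p⟩ = B p := by
    intro p
    change (LinearMap.ker A).liftQ B hker (A.quotKerEquivRange.symm _) = _
    rw [LinearMap.quotKerEquivRange_symm_apply_image]
    simp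
  let s : PointedCone ℝ E :=
    { carrier := {f | ∀ i, 0 ≤ (f : I → ℝ) i}
      add_mem' := fun hf hg i => add_nonneg (hf i) (hg i)
      zero_mem' := fun i => le_rfl
      smul_mem' := fun r _ hf i => mul_nonneg r.2 (hf i) }
  have hone : ∀ r : ℝ, ∀ i, (A (Finsupp.single x₀ r) : I → ℝ) i = r := by
    intro r i
    rw [hA, Finsupp.sum_single_index (by simp), hg₀, mul_one]
  obtain ⟨G, hG, hpos⟩ := riesz_extension s f
    (by
      rintro ⟨_, p, rfl⟩ hp
      rw [hf]
      exact hAB p hp)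
    (by
      -- Adding the constant `C`, a multiple of `g x₀`, makes a function bounded by `C` nonnegative;
      -- this is the cofinality that the Riesz theorem requires.
      rintro ⟨y, C, hC⟩
      refine ⟨⟨_, LinearMap.mem_range_self A (Finsupp.single x₀ C)⟩, fun i => ?_⟩
      change 0 ≤ (A (Finsupp.single x₀ C) : I → ℝ) i + y i
      rw [hone]
      linarith [(abs_le.1 (hC i)).1])
  have hGA : ∀ p, G (A p) = B p := fun p => (hG ⟨A p, LinearMap.mem_range_self A p⟩).trans (hf p)
  classical
  have hval : ∀ {f : I → ℝ} (h : IsBdd f),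
      (if h : IsBdd f then G ⟨f, h⟩ else 0) = G ⟨f, h⟩ := fun h => dif_pos h
  -- The value 0 on unbounded functions is harmless, since the laws of a mean only concern bounded
  -- ones.
  refine ⟨⟨fun f => if h : IsBdd f then G ⟨f, h⟩ else 0, ?_, ?_, ?_, ?_⟩, ?_⟩
  · intro f g hf hg h
    rw [hval hf, hval hg, ← sub_nonneg, ← map_sub]
    exact hpos _ fun i => sub_nonneg.2 (h i)
  · intro f g hf hg
    rw [hval hf, hval hg, hval (hf.add hg), ← map_add]
    rfl
  · intro r f hf
    rw [hval hf, hval (hf.smul r), ← smul_eq_mul, ← map_smul]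
    rfl
  · rw [hval (IsBdd.const 1)]
    have : (⟨fun _ => 1, IsBdd.const 1⟩ : E) = A (Finsupp.single x₀ 1) := by
      ext i
      exact (hone 1 i).symm
    rw [this, hGA, hB, Finsupp.sum_single_index (by simp), hc₀, mul_one]
  · intro x
    change (if h : IsBdd (g x) then G ⟨g x, h⟩ else 0) = c x
    rw [hval (hg x)]
    have : (⟨g x, hg x⟩ : E) = A (Finsupp.single x 1) := by
      ext i
      rw [hA, Finsupp.sum_single_index (by simp), one_mul]
    rw [this, hGA, hB, Finsupp.sum_single_index (by simp), one_mul]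

end Mean

/-! ### Powers by a mean -/

namespace PreStructure

theorem isBdd_d (M : PreStructure S) {I : Type*} (a b : I → M.carrier) :
    IsBdd fun i => M.d (a i) (b i) :=
  ⟨1, fun i => by rw [abs_of_nonneg (M.d_nonneg _ _)]; exact M.d_le_one _ _⟩

theorem isBdd_rel (M : PreStructure S) {I : Type*} (R : S.Rel)
    (a : I → Fin (S.relArity R) → M.carrier) : IsBdd fun i => M.rel R (a i) :=
  ⟨1, fun i => by rw [abs_of_nonneg (M.rel_mem R _).1]; exact (M.rel_mem R _).2⟩

theorem isBdd_val (M : PreStructure S) {I : Type*} (φ : Formula S) (v : I → ℕ → M.carrier) :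
    IsBdd fun i => M.val φ (v i) := by
  obtain ⟨C, -, h⟩ := exists_abs_val_le φ
  exact ⟨C, fun i => h M _⟩

/-- The power of a structure by a mean. -/
@[reducible] def meanPower (M : PreStructure S) {I : Type u} (μ : Mean I) : PreStructure S where
  carrier := I → M.carrier
  d a b := μ.toFun fun i => M.d (a i) (b i)
  d_self a := by simpa only [M.d_self] using μ.const 0
  d_comm a b := by simp only [M.d_comm]
  d_triangle a b c := by
    rw [← μ.add (M.isBdd_d _ _) (M.isBdd_d _ _)]
    exact μ.mono (M.isBdd_d _ _) ((M.isBdd_d _ _).add (M.isBdd_d _ _))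
      fun i => M.d_triangle _ _ _
  d_le_one a b :=
    (μ.mono (M.isBdd_d _ _) (IsBdd.const 1) fun i => M.d_le_one _ _).trans μ.one.le
  const c _ := M.const c
  func F a i := M.func F fun j => a j i
  func_lipschitz F a b := by
    rw [← μ.sum _ fun j => M.isBdd_d _ _, ← μ.smul _ (IsBdd.sum _ fun j => M.isBdd_d _ _)]
    exact μ.mono (M.isBdd_d _ _) ((IsBdd.sum _ fun j => M.isBdd_d _ _).smul _)
      fun i => M.func_lipschitz F _ _
  rel R a := μ.toFun fun i => M.rel R fun j => a j i
  rel_mem R a :=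
    ⟨(μ.const 0).symm.le.trans
      (μ.mono (IsBdd.const 0) (M.isBdd_rel R _) fun i => (M.rel_mem R _).1),
    (μ.mono (M.isBdd_rel R _) (IsBdd.const 1) fun i => (M.rel_mem R _).2).trans μ.one.le⟩
  rel_lipschitz R a b := by
    rw [sub_le_iff_le_add, ← μ.sum _ fun j => M.isBdd_d _ _,
      ← μ.smul _ (IsBdd.sum _ fun j => M.isBdd_d _ _),
      ← μ.add ((IsBdd.sum _ fun j => M.isBdd_d _ _).smul _) (M.isBdd_rel R _)]
    exact μ.mono (M.isBdd_rel R _) (((IsBdd.sum _ fun j => M.isBdd_d _ _).smul _).add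
      (M.isBdd_rel R _)) fun i => sub_le_iff_le_add.1 (M.rel_lipschitz R _ _)

theorem tval_meanPower (M : PreStructure S) {I : Type u} (μ : Mean I) (v : ℕ → I → M.carrier)
    (t : Term S) : (M.meanPower μ).tval v t = fun i => M.tval (fun x => v x i) t := by
  induction t with
  | var x => rfl
  | const c => rfl
  | func F ts ih =>
    rw [tval]
    simp only [ih]
    rfl

theorem update_apply_index {I C : Type*} (v : ℕ → I → C) (x : ℕ) (b : I → C) (i : I) :
    (fun y => Function.update v x b y i) = Function.update (fun y => v y i) x (b i) := by
  ext y
  by_cases h : y = x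
  · subst h; simp
  · simp [h]

/-- The integral theorem for mean powers. -/
theorem val_meanPower (M : PreStructure S) {I : Type u} (μ : Mean I) (φ : Formula S)
    (v : ℕ → I → M.carrier) :
    (M.meanPower μ).val φ v = μ.toFun fun i => M.val φ fun x => v x i := by
  induction φ generalizing v with
  | one => exact μ.one.symm
  | dist t₁ t₂ => rw [val, tval_meanPower, tval_meanPower]; rfl
  | rel R ts =>
    rw [val]
    simp only [tval_meanPower]
    rfl
  | add φ ψ hφ hψ =>
    rw [val, hφ, hψ, ← μ.add (M.isBdd_val _ _) (M.isBdd_val _ _)]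
    rfl
  | smul r φ hφ =>
    rw [val, hφ, ← μ.smul r (M.isBdd_val _ _)]
    rfl
  | inf x φ hφ =>
    have key : ∀ b : I → M.carrier, (M.meanPower μ).val φ (Function.update v x b) =
        μ.toFun fun i => M.val φ (Function.update (fun y => v y i) x (b i)) := by
      intro b
      rw [hφ]
      simp only [update_apply_index]
    apply le_antisymm
    · refine le_of_forall_pos_le_add fun ε hε => ?_
      -- Near-minimisers chosen separately at each index form a single element of the power, since
      -- its carrier is all of `I → M.carrier`. No measurability arises because the mean integrates
      -- every bounded function.
      have : ∀ i, ∃ b, M.val φ (Function.update (fun y => v y i) x b) <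
          M.val (.inf x φ) (fun y => v y i) + ε := fun i =>
        exists_lt_of_ciInf_lt (lt_add_of_pos_right _ hε)
      choose b hb using this
      refine ((M.meanPower μ).val_inf_le x φ v b).trans ?_
      rw [key, ← μ.add_const (M.isBdd_val _ _)]
      exact μ.mono (M.isBdd_val _ _) ((M.isBdd_val _ _).add (IsBdd.const _)) fun i => (hb i).le
    · refine le_ciInf fun b => ?_
      rw [key]
      exact μ.mono (M.isBdd_val _ _) (M.isBdd_val _ _) fun i => M.val_inf_le x φ _ _
  | sup x φ hφ =>
    have key : ∀ b : I → M.carrier, (M.meanPower μ).val φ (Function.update v x b) =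
        μ.toFun fun i => M.val φ (Function.update (fun y => v y i) x (b i)) := by
      intro b
      rw [hφ]
      simp only [update_apply_index]
    apply le_antisymm
    · refine ciSup_le fun b => ?_
      rw [key]
      exact μ.mono (M.isBdd_val _ _) (M.isBdd_val _ _) fun i => M.le_val_sup x φ _ _
    · refine le_of_forall_pos_le_add fun ε hε => ?_
      have : ∀ i, ∃ b, M.val (.sup x φ) (fun y => v y i) - ε <
          M.val φ (Function.update (fun y => v y i) x b) := fun i =>
        exists_lt_of_lt_ciSup (sub_lt_self _ hε)
      choose b hb using this
      refine le_trans ?_ (add_le_add_left ((M.meanPower μ).le_val_sup x φ v b) ε)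
      rw [key, ← μ.add_const (M.isBdd_val _ _)]
      exact μ.mono (M.isBdd_val _ _) ((M.isBdd_val _ _).add (IsBdd.const _))
        fun i => sub_le_iff_le_add.1 (hb i).le

/-! ### Elementary maps and partial elementary relations -/

/-- `f` preserves the values of the `L`-formulas. -/
def IsElementary (L : Language S) (M N : PreStructure S) (f : M.carrier → N.carrier) : Prop :=
  ∀ φ : Formula S, φ.In L → ∀ v, N.val φ (f ∘ v) = M.val φ v

/-- Tuples related by `E` satisfy the same `L`-formulas. -/
def IsPartialElementary (L : Language S) (M N : PreStructure S)
    (E : M.carrier → N.carrier → Prop) : Prop :=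
  ∀ φ : Formula S, φ.In L → ∀ v w, (∀ x ∈ φ.freeVars, E (v x) (w x)) → M.val φ v = N.val φ w

theorem IsPartialElementary.d_eq {L : Language S} {M N : PreStructure S}
    {E : M.carrier → N.carrier → Prop} (hE : IsPartialElementary L M N E) {a a' : M.carrier}
    {b b' : N.carrier} (h : E a b) (h' : E a' b') : M.d a a' = N.d b b' := by
  have := hE (.dist (.var 0) (.var 1)) ⟨trivial, trivial⟩ (fun n => if n = 0 then a else a')
    (fun n => if n = 0 then b else b') fun x _ => by by_cases hx : x = 0 <;> simp [hx, h, h']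
  simpa [val, tval] using this

/-- This is the positivity behind amalgamation. Taking the infimum over the variables whose values
have no partner leaves a formula about related points only, whose value is the same in `M` and `N`;
in `M` it is nonnegative because every choice of values comes from an admissible `i`. -/
theorem IsPartialElementary.nonneg {L : Language S} {M N : PreStructure S}
    {E : M.carrier → N.carrier → Prop} (hE : IsPartialElementary L M N E) {φ : Formula S}
    (hφ : φ.In L) {w : ℕ → N.carrier} (hw : Set.InjOn w φ.freeVars)
    (h : ∀ i : N.carrier → M.carrier, (∀ a b, E a b → M.d (i b) a = 0) → 0 ≤ M.val φ (i ∘ w)) :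
    0 ≤ N.val φ w := by
  classical
  let k : N.carrier → M.carrier := fun b =>
    if hb : ∃ a, E a b then hb.choose else Classical.arbitrary _
  have hk : ∀ b, (∃ a, E a b) → E (k b) b := by
    intro b hb
    simp only [k, dif_pos hb]
    exact hb.choose_spec
  let s : Finset ℕ := φ.finite_freeVars.toFinset.filter fun x => ¬ ∃ a, E a (w x)
  have hs : ∀ x, x ∈ s ↔ x ∈ φ.freeVars ∧ ¬ ∃ a, E a (w x) := by simp [s]
  obtain ⟨ψ, hψ, hfv, hle, hge⟩ := φ.exists_inf hφ s
  refine le_trans ?_ (hle N w)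
  rw [← hE ψ hψ (k ∘ w) w]
  · refine hge M (k ∘ w) 0 fun u hu => ?_
    -- The values `u` are attached to variables, whereas `i` is defined on points of `N`;
    -- injectivity of `w` on the free variables makes the conversion consistent.
    let i : N.carrier → M.carrier := fun b =>
      if ∃ a, E a b then k b
      else if hx : ∃ x ∈ φ.freeVars, w x = b then u hx.choose else Classical.arbitrary _
    have hi : ∀ a b, E a b → M.d (i b) a = 0 := by
      intro a b hab
      simp only [i, if_pos (⟨a, hab⟩ : ∃ a, E a b)]
      -- Two partners of the same point are at distance zero, so the choice made by `k` does not
      -- matter.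
      rw [hE.d_eq (hk b ⟨a, hab⟩) hab, N.d_self]
    refine (h i hi).trans_eq (M.val_congr φ fun x hx => ?_)
    by_cases hxe : ∃ a, E a (w x)
    · rw [hu x fun hxs => ((hs x).1 hxs).2 hxe]
      simp only [i, Function.comp, if_pos hxe]
    · have hex : ∃ y ∈ φ.freeVars, w y = w x := ⟨x, hx, rfl⟩
      simp only [i, Function.comp, if_neg hxe, dif_pos hex]
      rw [hw hex.choose_spec.1 hx hex.choose_spec.2]
  · intro x hx
    obtain ⟨hxφ, hxs⟩ := hfv hx
    refine hk _ (not_not.1 fun hne => hxs ((hs x).2 ⟨hxφ, hne⟩))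

end PreStructure

/-! ### Amalgamation inside a mean power -/

/-- A linear combination of values of formulas is the value of one formula, at an assignment that
is injective on its free variables. -/
theorem exists_formula_finsuppSum {L : Language S} {C X : Type*} [Nonempty C] (φ : X → Formula S)
    (hφ : ∀ x, (φ x).In L) (v : X → ℕ → C) (p : X →₀ ℝ) :
    ∃ ψ : Formula S, ψ.In L ∧ ∃ w : ℕ → C, Set.InjOn w ψ.freeVars ∧
      ∀ (K : PreStructure S) (i : C → K.carrier),
        K.val ψ (i ∘ w) = p.sum fun x r => r * K.val (φ x) (i ∘ v x) := by
  classical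
  let B : Set C := ⋃ x ∈ p.support, v x '' (φ x).freeVars
  have hB : B.Finite :=
    p.support.finite_toSet.biUnion fun x _ => (φ x).finite_freeVars.image _
  -- Each of the finitely many points involved gets its own variable, so that equal points share a
  -- variable and `w` is injective on the free variables, as `IsPartialElementary.nonneg` demands.
  obtain ⟨ρ, hρ⟩ := Set.countable_iff_exists_injOn.1 hB.countable
  let w : ℕ → C := Function.invFunOn ρ B
  have hw : ∀ b ∈ B, w (ρ b) = b := fun b hb => hρ.leftInvOn_invFunOn hb
  have key : ∀ s ⊆ p.support, ∃ ψ : Formula S, ψ.In L ∧ ψ.freeVars ⊆ ρ '' B ∧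
      ∀ (K : PreStructure S) (i : C → K.carrier),
        K.val ψ (i ∘ w) = ∑ x ∈ s, p x * K.val (φ x) (i ∘ v x) := by
    intro s
    induction s using Finset.induction_on with
    | empty =>
      exact fun _ => ⟨.smul 0 .one, trivial, by simp [Formula.freeVars],
        fun K i => by simp [PreStructure.val]⟩
    | insert x s hx ih =>
      intro hs
      rw [Finset.insert_subset_iff] at hs
      obtain ⟨ψ, h1, h2, h3⟩ := ih hs.2
      obtain ⟨χ, g1, g2, g3⟩ := (φ x).exists_rename (hφ x) (ρ ∘ v x)
      have hxB : ∀ y ∈ (φ x).freeVars, v x y ∈ B := fun y hy =>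
        Set.mem_biUnion hs.1 ⟨y, hy, rfl⟩
      refine ⟨.add (.smul (p x) χ) ψ, ⟨g1, h1⟩, Set.union_subset (g2.trans ?_) h2, fun K i => ?_⟩
      · rintro _ ⟨y, hy, rfl⟩
        exact ⟨v x y, hxB y hy, rfl⟩
      · rw [Finset.sum_insert hx, ← h3, PreStructure.val, PreStructure.val, g3]
        congr 2
        exact K.val_congr _ fun y hy => by simp [hw _ (hxB y hy)]
  obtain ⟨ψ, h1, h2, h3⟩ := key p.support subset_rfl
  refine ⟨ψ, h1, w, ?_, h3⟩
  intro a ha b hb hab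
  obtain ⟨a', ha', rfl⟩ := h2 ha
  obtain ⟨b', hb', rfl⟩ := h2 hb
  rw [hw _ ha', hw _ hb'] at hab
  rw [hab]

/-- The language of all symbols. -/
def Language.all (S : Symbols.{u}) : Language S :=
  ⟨Set.univ, Set.univ, Set.univ⟩

theorem Term.in_all (t : Term S) : t.In (Language.all S) := by
  induction t with
  | var x => trivial
  | const c => trivial
  | func F ts ih => exact ⟨trivial, ih⟩

theorem Formula.in_all (φ : Formula S) : φ.In (Language.all S) := by
  induction φ with
  | one => trivial
  | dist t₁ t₂ => exact ⟨t₁.in_all, t₂.in_all⟩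
  | rel R ts => exact ⟨trivial, fun i => (ts i).in_all⟩
  | add φ ψ hφ hψ => exact ⟨hφ, hψ⟩
  | smul r φ h => exact h
  | inf x φ h => exact h
  | sup x φ h => exact h

namespace PreStructure

/-- Amalgamation of a partial elementary relation: some elementary extension of `M` contains an
`L`-elementary image of `N` compatible with the relation. -/
theorem IsPartialElementary.exists_amalgam {L : Language S} {M N : PreStructure S}
    {E : M.carrier → N.carrier → Prop} (hE : IsPartialElementary L M N E) :
    ∃ (M' : PreStructure S) (e : M.carrier → M'.carrier) (g : N.carrier → M'.carrier),
      IsElementary (Language.all S) M M' e ∧ IsElementary L N M' g ∧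
        ∀ a b, E a b → M'.d (g b) (e a) = 0 := by
  -- A point `b` of `N` becomes the evaluation `i ↦ i b`; the constraint on `i` forces it to
  -- distance zero from the constant function of any partner of `b`.
  let I := {i : N.carrier → M.carrier // ∀ a b, E a b → M.d (i b) a = 0}
  let X := {φ : Formula S // φ.In L} × (ℕ → N.carrier)
  obtain ⟨μ, hμ⟩ := Mean.exists_extension (I := I) (X := X) (fun x i => M.val x.1.1 (i.1 ∘ x.2))
    (fun x => M.isBdd_val _ _) (fun x => N.val x.1.1 x.2)
    (by
      intro p hp
      obtain ⟨ψ, hψ, w, hw, h⟩ := exists_formula_finsuppSum (fun x : X => x.1.1)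
        (fun x => x.1.2) (fun x => x.2) p
      have := h N id
      simp only [Function.id_comp] at this
      rw [← this]
      refine hE.nonneg hψ hw fun i hi => ?_
      rw [h M i]
      exact hp ⟨i, hi⟩)
    (⟨.one, trivial⟩, fun _ => Classical.arbitrary _) (fun i => rfl) rfl
  refine ⟨M.meanPower μ, fun a _ => a, fun b i => i.1 b, ?_, ?_, ?_⟩
  · intro φ _ v
    rw [val_meanPower]
    exact μ.const (M.val φ v)
  · intro φ hφ v
    rw [val_meanPower]
    exact hμ (⟨φ, hφ⟩, v)
  · intro a b hab
    change μ.toFun (fun i : I => M.d (i.1 b) a) = 0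
    simp only [fun i : I => i.2 a b hab]
    exact μ.const 0

end PreStructure

/-! ### Morphisms, and when they are elementary -/

namespace PreStructure

/-- `f` preserves the metric and the interpretations of the symbols of `L`. -/
structure IsMorphism (L : Language S) (M N : PreStructure S) (f : M.carrier → N.carrier) :
    Prop where
  d_map : ∀ a b, N.d (f a) (f b) = M.d a b
  map_const : ∀ c ∈ L.consts, N.d (f (M.const c)) (N.const c) = 0
  map_func : ∀ F ∈ L.funcs, ∀ a, N.d (f (M.func F a)) (N.func F (f ∘ a)) = 0
  map_rel : ∀ R ∈ L.rels, ∀ a, N.rel R (f ∘ a) = M.rel R a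

theorem IsMorphism.d_map_zero {L : Language S} {M N : PreStructure S}
    {f : M.carrier → N.carrier} (hf : IsMorphism L M N f) {a b : M.carrier} (h : M.d a b = 0) :
    N.d (f a) (f b) = 0 := by
  rw [hf.d_map, h]

theorem IsMorphism.map_tval {L : Language S} {M N : PreStructure S}
    {f : M.carrier → N.carrier} (hf : IsMorphism L M N f) (v : ℕ → M.carrier) (t : Term S)
    (ht : t.In L) : N.d (f (M.tval v t)) (N.tval (f ∘ v) t) = 0 := by
  induction t with
  | var x => exact N.d_self _
  | const c => exact hf.map_const c ht
  | func F ts ih =>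
    exact N.d_zero_trans (hf.map_func F ht.1 _) (N.func_congr F fun i => ih i (ht.2 i))

theorem IsMorphism.val_dist {L : Language S} {M N : PreStructure S}
    {f : M.carrier → N.carrier} (hf : IsMorphism L M N f) (v : ℕ → M.carrier) (t₁ t₂ : Term S)
    (h : (Formula.dist t₁ t₂).In L) :
    N.val (.dist t₁ t₂) (f ∘ v) = M.val (.dist t₁ t₂) v := by
  rw [val, val, ← hf.d_map]
  exact (N.d_congr (hf.map_tval v t₁ h.1) (hf.map_tval v t₂ h.2)).symm

theorem IsMorphism.val_rel {L : Language S} {M N : PreStructure S}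
    {f : M.carrier → N.carrier} (hf : IsMorphism L M N f) (v : ℕ → M.carrier) (R : S.Rel)
    (ts : Fin (S.relArity R) → Term S) (h : (Formula.rel R ts).In L) :
    N.val (.rel R ts) (f ∘ v) = M.val (.rel R ts) v := by
  rw [val, val, ← hf.map_rel R h.1]
  exact (N.rel_congr R fun i => hf.map_tval v (ts i) (h.2 i)).symm

theorem IsElementary.d_map {L : Language S} {M N : PreStructure S}
    {f : M.carrier → N.carrier} (hf : IsElementary L M N f) (a b : M.carrier) :
    N.d (f a) (f b) = M.d a b := by
  simpa [val, tval] using hf (.dist (.var 0) (.var 1)) ⟨trivial, trivial⟩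
    fun n => if n = 0 then a else b

theorem IsElementary.isMorphism {L : Language S} {M N : PreStructure S}
    {f : M.carrier → N.carrier} (hf : IsElementary L M N f) : IsMorphism L M N f where
  d_map := hf.d_map
  map_const c hc := by
    have := hf (.dist (.var 0) (.const c)) ⟨trivial, hc⟩ fun _ => M.const c
    simpa [val, tval, M.d_self] using this
  map_func F hF a := by
    -- The variable with index `S.funcArity F` is the first one not used for an argument; it holds
    -- the value of the function.
    have := hf (.dist (.var (S.funcArity F)) (.func F fun i => .var i))
      ⟨trivial, hF, fun _ => trivial⟩
      fun n => if h : n < S.funcArity F then a ⟨n, h⟩ else M.func F a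
    simpa [val, tval, M.d_self, Function.comp_def] using this
  map_rel R hR a := by
    have := hf (.rel R fun i => .var i) ⟨hR, fun _ => trivial⟩
      fun n => if h : n < S.relArity R then a ⟨n, h⟩ else Classical.arbitrary _
    simpa [val, tval, Function.comp_def] using this

/-- A morphism with dense range is elementary. -/
theorem IsMorphism.isElementary {L : Language S} {M N : PreStructure S}
    {f : M.carrier → N.carrier} (hf : IsMorphism L M N f)
    (hd : ∀ b, ∀ ε > 0, ∃ a, N.d (f a) b ≤ ε) : IsElementary L M N f := by
  have key : ∀ φ : Formula S, ∀ x v b, ∀ ε > 0, ∃ a,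
      |N.val φ (f ∘ Function.update v x a) - N.val φ (Function.update (f ∘ v) x b)| ≤ ε := by
    intro φ x v b ε hε
    obtain ⟨C, hC, h⟩ := N.exists_abs_val_sub_val_le φ
    -- The denominator is `C + 1` because the Lipschitz constant `C` may be zero.
    obtain ⟨a, ha⟩ := hd b (ε / (C + 1)) (by positivity)
    refine ⟨a, (h _ _ (ε / (C + 1)) (by positivity) fun y _ => ?_).trans ?_⟩
    · rw [Function.comp_update]
      by_cases hy : y = x
      · subst hy; simpa using ha
      · simpa [hy, N.d_self] using (by positivity : 0 ≤ ε / (C + 1))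
    · rw [mul_div_assoc', div_le_iff₀ (by positivity)]
      nlinarith
  intro φ hφ
  induction φ with
  | one => exact fun v => rfl
  | dist t₁ t₂ => exact fun v => hf.val_dist v t₁ t₂ hφ
  | rel R ts => exact fun v => hf.val_rel v R ts hφ
  | add φ ψ h h' => exact fun v => congrArg₂ (· + ·) (h hφ.1 v) (h' hφ.2 v)
  | smul r φ h => exact fun v => congrArg (r * ·) (h hφ v)
  | inf x φ h =>
    refine fun v => le_antisymm (le_ciInf fun a => ?_) (le_ciInf fun b => ?_)
    · rw [← h hφ, Function.comp_update]
      exact N.val_inf_le x φ _ _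
    · refine le_of_forall_pos_le_add fun ε hε => ?_
      obtain ⟨a, ha⟩ := key φ x v b ε hε
      rw [h hφ] at ha
      linarith [M.val_inf_le x φ v a, (abs_le.1 ha).2]
  | sup x φ h =>
    refine fun v => le_antisymm (ciSup_le fun b => ?_) (ciSup_le fun a => ?_)
    · refine le_of_forall_pos_le_add fun ε hε => ?_
      obtain ⟨a, ha⟩ := key φ x v b ε hε
      rw [h hφ] at ha
      linarith [M.le_val_sup x φ v a, (abs_le.1 ha).1]
    · rw [← h hφ, Function.comp_update]
      exact N.le_val_sup x φ _ _

/-! ### Unions of elementary chains -/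

section Limit

variable (M : ℕ → PreStructure S) (e : ∀ n, (M n).carrier → (M (n + 1)).carrier)

/-- The transition maps of a chain. -/
def trans {n k : ℕ} (h : n ≤ k) : (M n).carrier → (M k).carrier :=
  Nat.leRecOn (C := fun n => (M n).carrier) h fun {k} => e k

theorem trans_self {n : ℕ} (a : (M n).carrier) : trans M e le_rfl a = a :=
  Nat.leRecOn_self (C := fun n => (M n).carrier) a

theorem trans_succ {n k : ℕ} (h : n ≤ k) (a : (M n).carrier) :
    trans M e (h.trans (Nat.le_succ k)) a = e k (trans M e h a) :=
  Nat.leRecOn_succ (C := fun n => (M n).carrier) h a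

theorem trans_trans {n k m : ℕ} (h : n ≤ k) (h' : k ≤ m) (a : (M n).carrier) :
    trans M e h' (trans M e h a) = trans M e (h.trans h') a :=
  (Nat.leRecOn_trans (C := fun n => (M n).carrier) h h' a).symm

variable {M e}

theorem isElementary_trans (he : ∀ n, IsElementary (Language.all S) (M n) (M (n + 1)) (e n))
    {n k : ℕ} (h : n ≤ k) : IsElementary (Language.all S) (M n) (M k) (trans M e h) := by
  induction k, h using Nat.le_induction with
  | base =>
    intro φ _ v
    congr 1
    ext x
    exact trans_self M e _
  | succ k h ih =>
    intro φ hφ v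
    rw [← ih φ hφ v, ← he k φ hφ]
    congr 1
    ext x
    exact trans_succ M e h _

theorem isMorphism_trans (he : ∀ n, IsElementary (Language.all S) (M n) (M (n + 1)) (e n))
    {n k : ℕ} (h : n ≤ k) : IsMorphism (Language.all S) (M n) (M k) (trans M e h) :=
  (isElementary_trans he h).isMorphism

variable (M e) in
/-- The distance in the union of a chain. -/
def limitDist (p q : Σ n, (M n).carrier) : ℝ :=
  (M (max p.1 q.1)).d (trans M e (le_max_left _ _) p.2) (trans M e (le_max_right _ _) q.2)

/-- Transition maps preserve distances, so any common later stage computes the same number; the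
axioms for the union can then be checked at a single stage. -/
theorem limitDist_eq (he : ∀ n, IsElementary (Language.all S) (M n) (M (n + 1)) (e n))
    (p q : Σ n, (M n).carrier) {K : ℕ} (hp : p.1 ≤ K) (hq : q.1 ≤ K) :
    limitDist M e p q = (M K).d (trans M e hp p.2) (trans M e hq q.2) := by
  rw [limitDist, ← (isMorphism_trans he (max_le hp hq)).d_map, trans_trans, trans_trans]

/-- A stage at which all the members of a tuple are present. -/
def stage {n : ℕ} (p : Fin n → Σ n, (M n).carrier) : ℕ := Finset.univ.sup fun i => (p i).1

theorem le_stage {n : ℕ} (p : Fin n → Σ n, (M n).carrier) (i : Fin n) : (p i).1 ≤ stage p :=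
  Finset.le_sup (f := fun i => (p i).1) (Finset.mem_univ i)

theorem trans_func (he : ∀ n, IsElementary (Language.all S) (M n) (M (n + 1)) (e n)) (F : S.Func)
    (p : Fin (S.funcArity F) → Σ n, (M n).carrier) {k K : ℕ} (hp : ∀ i, (p i).1 ≤ k)
    (hK : k ≤ K) :
    (M K).d (trans M e hK ((M k).func F fun i => trans M e (hp i) (p i).2))
      ((M K).func F fun i => trans M e ((hp i).trans hK) (p i).2) = 0 := by
  have := (isMorphism_trans he hK).map_func F trivial fun i => trans M e (hp i) (p i).2
  simpa only [Function.comp_def, trans_trans] using this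

theorem trans_rel (he : ∀ n, IsElementary (Language.all S) (M n) (M (n + 1)) (e n)) (R : S.Rel)
    (p : Fin (S.relArity R) → Σ n, (M n).carrier) {k K : ℕ} (hp : ∀ i, (p i).1 ≤ k)
    (hK : k ≤ K) :
    (M k).rel R (fun i => trans M e (hp i) (p i).2) =
      (M K).rel R fun i => trans M e ((hp i).trans hK) (p i).2 := by
  have := (isMorphism_trans he hK).map_rel R trivial fun i => trans M e (hp i) (p i).2
  simpa only [Function.comp_def, trans_trans] using this.symm

/-- The union of an elementary chain. -/
def limit (he : ∀ n, IsElementary (Language.all S) (M n) (M (n + 1)) (e n)) :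
    PreStructure S where
  -- Nothing is identified: a point and its images at later stages remain distinct, at distance
  -- zero.
  carrier := Σ n, (M n).carrier
  d := limitDist M e
  d_self p := by rw [limitDist_eq he p p le_rfl le_rfl, d_self]
  d_comm p q := by
    rw [limitDist_eq he p q (le_max_left _ _) (le_max_right _ _),
      limitDist_eq he q p (le_max_right _ _) (le_max_left _ _), d_comm]
  d_triangle p q r := by
    have hp : p.1 ≤ p.1 + q.1 + r.1 := by omega
    have hq : q.1 ≤ p.1 + q.1 + r.1 := by omega
    have hr : r.1 ≤ p.1 + q.1 + r.1 := by omega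
    rw [limitDist_eq he p q hp hq, limitDist_eq he q r hq hr, limitDist_eq he p r hp hr]
    exact d_triangle _ _ _ _
  d_le_one p q := d_le_one _ _ _
  const c := ⟨0, (M 0).const c⟩
  func F p := ⟨stage p, (M (stage p)).func F fun i => trans M e (le_stage p i) (p i).2⟩
  func_lipschitz F p q := by
    rw [limitDist_eq he _ _ (le_max_left (stage p) (stage q)) (le_max_right (stage p) (stage q)),
      d_congr _ (trans_func he F p (le_stage p) (le_max_left _ _))
        (trans_func he F q (le_stage q) (le_max_right _ _))]
    refine (func_lipschitz _ F _ _).trans_eq ?_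
    congr 1
    exact Finset.sum_congr rfl fun i _ => (limitDist_eq he _ _ _ _).symm
  rel R p := (M (stage p)).rel R fun i => trans M e (le_stage p i) (p i).2
  rel_mem R p := rel_mem _ _ _
  rel_lipschitz R p q := by
    rw [trans_rel he R p (le_stage p) (le_max_left (stage p) (stage q)),
      trans_rel he R q (le_stage q) (le_max_right (stage p) (stage q))]
    refine (rel_lipschitz _ R _ _).trans_eq ?_
    congr 1
    exact Finset.sum_congr rfl fun i _ => (limitDist_eq he _ _ _ _).symm

/-- The embedding of a member of a chain into the union. -/
def toLimit (he : ∀ n, IsElementary (Language.all S) (M n) (M (n + 1)) (e n)) (n : ℕ)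
    (a : (M n).carrier) : (limit he).carrier := ⟨n, a⟩

theorem d_toLimit (he : ∀ n, IsElementary (Language.all S) (M n) (M (n + 1)) (e n)) {n k K : ℕ}
    (hn : n ≤ K) (hk : k ≤ K) (a : (M n).carrier) (b : (M k).carrier) :
    (limit he).d (toLimit he n a) (toLimit he k b) =
      (M K).d (trans M e hn a) (trans M e hk b) :=
  limitDist_eq he ⟨n, a⟩ ⟨k, b⟩ hn hk

theorem d_toLimit_trans (he : ∀ n, IsElementary (Language.all S) (M n) (M (n + 1)) (e n))
    {n k : ℕ} (h : n ≤ k) (a : (M n).carrier) :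
    (limit he).d (toLimit he k (trans M e h a)) (toLimit he n a) = 0 := by
  rw [d_toLimit he le_rfl h, trans_self, d_self]

theorem isMorphism_toLimit (he : ∀ n, IsElementary (Language.all S) (M n) (M (n + 1)) (e n))
    (n : ℕ) : IsMorphism (Language.all S) (M n) (limit he) (toLimit he n) where
  d_map a b := by rw [d_toLimit he le_rfl le_rfl, trans_self, trans_self]
  map_const c _ := by
    change (limit he).d (toLimit he n _) (toLimit he 0 _) = 0
    rw [d_toLimit he le_rfl (Nat.zero_le n), trans_self, d_comm]
    exact (isMorphism_trans he (Nat.zero_le n)).map_const c trivial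
  map_func F _ a := by
    have hs : stage (fun i => (⟨n, a i⟩ : Σ n, (M n).carrier)) ≤ n :=
      Finset.sup_le fun i _ => le_rfl
    change (limit he).d (toLimit he n _) (toLimit he (stage fun i => ⟨n, a i⟩)
      ((M _).func F fun i => trans M e (le_stage (fun i => ⟨n, a i⟩) i) (a i))) = 0
    rw [d_toLimit he le_rfl hs, trans_self, d_comm]
    have := trans_func he F (fun i => ⟨n, a i⟩) (le_stage _) hs
    simpa only [trans_self] using this
  map_rel R _ a := by
    have hs : stage (fun i => (⟨n, a i⟩ : Σ n, (M n).carrier)) ≤ n :=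
      Finset.sup_le fun i _ => le_rfl
    have := trans_rel he R (fun i => ⟨n, a i⟩) (le_stage _) hs
    simp only [trans_self] at this
    exact this

/-- The quantifier step for unions: a witness in the union appears at some stage, so the evaluation
can be moved to a stage containing both it and the parameters. For this the induction hypothesis
must hold at all stages at once. -/
theorem val_update_toLimit (he : ∀ n, IsElementary (Language.all S) (M n) (M (n + 1)) (e n))
    (φ : Formula S)
    (ih : ∀ n v, (limit he).val φ (toLimit he n ∘ v) = (M n).val φ v)
    {n : ℕ} (x : ℕ) (v : ℕ → (M n).carrier) (p : (limit he).carrier) :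
    ∃ (k : ℕ) (h : n ≤ k) (a : (M k).carrier),
      (limit he).val φ (Function.update (toLimit he n ∘ v) x p) =
        (M k).val φ (Function.update (trans M e h ∘ v) x a) := by
  refine ⟨max n p.1, le_max_left _ _, trans M e (le_max_right _ _) p.2, ?_⟩
  rw [← ih]
  refine (limit he).val_congr_d φ fun y _ => ?_
  rw [Function.comp_update, d_comm]
  by_cases hy : y = x
  · subst hy
    rw [Function.update_self, Function.update_self]
    exact d_toLimit_trans he _ _
  · simpa [hy] using d_toLimit_trans he _ _

/-- The members of an elementary chain are elementary in the union. -/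
theorem isElementary_toLimit (he : ∀ n, IsElementary (Language.all S) (M n) (M (n + 1)) (e n))
    (n : ℕ) : IsElementary (Language.all S) (M n) (limit he) (toLimit he n) := by
  intro φ _
  induction φ generalizing n with
  | one => exact fun v => rfl
  | dist t₁ t₂ => exact fun v => (isMorphism_toLimit he n).val_dist v t₁ t₂ (Formula.in_all _)
  | rel R ts => exact fun v => (isMorphism_toLimit he n).val_rel v R ts (Formula.in_all _)
  | add φ ψ h h' =>
    exact fun v => congrArg₂ (· + ·) (h n φ.in_all v) (h' n ψ.in_all v)
  | smul r φ h => exact fun v => congrArg (r * ·) (h n φ.in_all v)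
  | inf x φ h =>
    refine fun v => le_antisymm (le_ciInf fun a => ?_) (le_ciInf fun p => ?_)
    · rw [← h n φ.in_all, Function.comp_update]
      exact (limit he).val_inf_le x φ _ _
    · obtain ⟨k, hk, a, ha⟩ := val_update_toLimit he φ (fun n => h n φ.in_all) x v p
      rw [ha, ← isElementary_trans he hk _ (Formula.in_all _)]
      exact (M k).val_inf_le x φ _ _
  | sup x φ h =>
    refine fun v => le_antisymm (ciSup_le fun p => ?_) (ciSup_le fun a => ?_)
    · obtain ⟨k, hk, a, ha⟩ := val_update_toLimit he φ (fun n => h n φ.in_all) x v p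
      rw [ha, ← isElementary_trans he hk _ (Formula.in_all _)]
      exact (M k).le_val_sup x φ _ _
    · rw [← h n φ.in_all, Function.comp_update]
      exact (limit he).le_val_sup x φ _ _

end Limit

/-! ### Maps between unions of chains -/

/-- A map of chains commuting with the transition maps up to distance zero. -/
theorem d_map_trans {M N : ℕ → PreStructure S}
    {e : ∀ n, (M n).carrier → (M (n + 1)).carrier} {e' : ∀ n, (N n).carrier → (N (n + 1)).carrier}
    (he' : ∀ n, IsElementary (Language.all S) (N n) (N (n + 1)) (e' n))
    {f : ∀ n, (M n).carrier → (N n).carrier}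
    (hfe : ∀ n a, (N (n + 1)).d (f (n + 1) (e n a)) (e' n (f n a)) = 0) {n k : ℕ} (h : n ≤ k)
    (a : (M n).carrier) : (N k).d (f k (trans M e h a)) (trans N e' h (f n a)) = 0 := by
  induction k, h using Nat.le_induction with
  | base => rw [trans_self, trans_self, d_self]
  | succ k h ih =>
    rw [trans_succ M e h, trans_succ N e' h]
    exact (N (k + 1)).d_zero_trans (hfe k _) ((he' k).isMorphism.d_map_zero ih)

/-- The map of unions induced by a map of chains. -/
def limitMap {M N : ℕ → PreStructure S}
    {e : ∀ n, (M n).carrier → (M (n + 1)).carrier} {e' : ∀ n, (N n).carrier → (N (n + 1)).carrier}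
    (he : ∀ n, IsElementary (Language.all S) (M n) (M (n + 1)) (e n))
    (he' : ∀ n, IsElementary (Language.all S) (N n) (N (n + 1)) (e' n))
    (f : ∀ n, (M n).carrier → (N n).carrier) (p : (limit he).carrier) : (limit he').carrier :=
  toLimit he' p.1 (f p.1 p.2)

/-- A formula has finitely many free variables, so their values can be moved to one stage `K`, where
`f K` is elementary. -/
theorem isElementary_limitMap {L : Language S} {M N : ℕ → PreStructure S}
    {e : ∀ n, (M n).carrier → (M (n + 1)).carrier} {e' : ∀ n, (N n).carrier → (N (n + 1)).carrier}
    (he : ∀ n, IsElementary (Language.all S) (M n) (M (n + 1)) (e n))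
    (he' : ∀ n, IsElementary (Language.all S) (N n) (N (n + 1)) (e' n))
    {f : ∀ n, (M n).carrier → (N n).carrier} (hf : ∀ n, IsElementary L (M n) (N n) (f n))
    (hfe : ∀ n a, (N (n + 1)).d (f (n + 1) (e n a)) (e' n (f n a)) = 0) :
    IsElementary L (limit he) (limit he') (limitMap he he' f) := by
  intro φ hφ v
  let K := φ.finite_freeVars.toFinset.sup fun x => (v x).1
  have hK : ∀ x ∈ φ.freeVars, (v x).1 ≤ K := fun x hx =>
    Finset.le_sup (f := fun x => (v x).1) (φ.finite_freeVars.mem_toFinset.2 hx)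
  let u : ℕ → (M K).carrier := fun x =>
    if h : (v x).1 ≤ K then trans M e h (v x).2 else Classical.arbitrary _
  have hu : ∀ x (h : (v x).1 ≤ K), u x = trans M e h (v x).2 := fun x h => dif_pos h
  have h1 : (limit he).val φ v = (limit he).val φ (toLimit he K ∘ u) := by
    refine (limit he).val_congr_d φ fun x hx => ?_
    rw [Function.comp, hu x (hK x hx), d_comm]
    exact d_toLimit_trans he _ _
  have h2 : (limit he').val φ (limitMap he he' f ∘ v) =
      (limit he').val φ (toLimit he' K ∘ f K ∘ u) := by
    refine (limit he').val_congr_d φ fun x hx => ?_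
    simp only [Function.comp, hu x (hK x hx), limitMap]
    rw [d_comm, d_toLimit he' le_rfl (hK x hx), trans_self]
    exact d_map_trans he' hfe _ _
  rw [h1, h2, isElementary_toLimit he' K φ φ.in_all, isElementary_toLimit he K φ φ.in_all,
    hf K φ hφ]

/-- The backward maps give surjectivity up to distance zero: a point of `N n` acquires a preimage in
`M (n + 1)`. -/
theorem exists_d_limitMap_eq_zero {M N : ℕ → PreStructure S}
    {e : ∀ n, (M n).carrier → (M (n + 1)).carrier} {e' : ∀ n, (N n).carrier → (N (n + 1)).carrier}
    (he : ∀ n, IsElementary (Language.all S) (M n) (M (n + 1)) (e n))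
    (he' : ∀ n, IsElementary (Language.all S) (N n) (N (n + 1)) (e' n))
    {f : ∀ n, (M n).carrier → (N n).carrier} {g : ∀ n, (N n).carrier → (M (n + 1)).carrier}
    (hfg : ∀ n b, (N (n + 1)).d (f (n + 1) (g n b)) (e' n b) = 0) (q : (limit he').carrier) :
    ∃ p, (limit he').d (limitMap he he' f p) q = 0 := by
  obtain ⟨n, b⟩ := q
  refine ⟨toLimit he (n + 1) (g n b), ?_⟩
  change (limit he').d (toLimit he' (n + 1) (f (n + 1) (g n b))) (toLimit he' n b) = 0
  rw [d_toLimit he' le_rfl (Nat.le_succ n), trans_self, trans_succ N e' le_rfl, trans_self]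
  exact hfg n b

/-! ### Gluing two structures along an isomorphism of the common part -/

/-- Let `M` and `N` be isomorphic over `L₁ ∩ L₂`, up to points at distance zero. Then `M` carries a
structure that agrees with `M` on `L₁` and with `N` on `L₂`. -/
theorem exists_common_expansion {L₁ L₂ : Language S} {M N : PreStructure S}
    {f : M.carrier → N.carrier} (hf : IsElementary (L₁ ∩ L₂) M N f)
    (hs : ∀ q, ∃ p, N.d (f p) q = 0) :
    ∃ P : PreStructure S,
      (∀ φ : Formula S, φ.In L₁ → φ.IsSentence → ∀ v w, P.val φ v = M.val φ w) ∧
      ∀ φ : Formula S, φ.In L₂ → φ.IsSentence → ∀ v w, P.val φ v = N.val φ w := by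
  classical
  choose g hg using hs
  have hfm := hf.isMorphism
  have hgd : ∀ a b, M.d (g a) (g b) = N.d a b := fun a b => by
    rw [← hfm.d_map]; exact N.d_congr (hg a) (hg b)
  let P : PreStructure S :=
    -- Symbols outside `L₁` are pulled back from `N` along `f`, with `g` as an inverse up to
    -- distance zero. On shared symbols the interpretation of `M` is kept, and `f` matches it with
    -- that of `N`.
    { carrier := M.carrier
      d := M.d
      d_self := M.d_self
      d_comm := M.d_comm
      d_triangle := M.d_triangle
      d_le_one := M.d_le_one
      const := fun c => if c ∈ L₁.consts then M.const c else g (N.const c)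
      func := fun F a => if F ∈ L₁.funcs then M.func F a else g (N.func F (f ∘ a))
      func_lipschitz := fun F a b => by
        split_ifs
        · exact M.func_lipschitz F a b
        · rw [hgd]
          refine (N.func_lipschitz F _ _).trans_eq ?_
          simp only [Function.comp, hfm.d_map]
      rel := fun R a => if R ∈ L₁.rels then M.rel R a else N.rel R (f ∘ a)
      rel_mem := fun R a => by
        split_ifs
        · exact M.rel_mem R a
        · exact N.rel_mem R _
      rel_lipschitz := fun R a b => by
        split_ifs
        · exact M.rel_lipschitz R a b
        · refine (N.rel_lipschitz R _ _).trans_eq ?_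
          simp only [Function.comp, hfm.d_map] }
  have h1 : IsMorphism L₁ M P id :=
    { d_map := fun _ _ => rfl
      map_const := fun c hc => by
        change M.d (M.const c) (if c ∈ L₁.consts then M.const c else g (N.const c)) = 0
        rw [if_pos hc, M.d_self]
      map_func := fun F hF a => by
        change M.d (M.func F a) (if F ∈ L₁.funcs then M.func F a else g (N.func F (f ∘ a))) = 0
        rw [if_pos hF, M.d_self]
      map_rel := fun R hR a => if_pos hR }
  have h2 : IsMorphism L₂ P N f :=
    { d_map := hfm.d_map
      map_const := fun c hc => by
        change N.d (f (if c ∈ L₁.consts then M.const c else g (N.const c))) (N.const c) = 0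
        split_ifs with h
        · exact hfm.map_const c ⟨h, hc⟩
        · exact hg _
      map_func := fun F hF a => by
        change N.d (f (if F ∈ L₁.funcs then M.func F a else g (N.func F (f ∘ a))))
          (N.func F (f ∘ a)) = 0
        split_ifs with h
        · exact hfm.map_func F ⟨h, hF⟩ a
        · exact hg _
      map_rel := fun R hR a => by
        change N.rel R (f ∘ a) = if R ∈ L₁.rels then M.rel R a else N.rel R (f ∘ a)
        split_ifs with h
        · exact hfm.map_rel R ⟨h, hR⟩ a
        · rfl }
  have e1 := h1.isElementary fun b ε hε => ⟨b, (M.d_self b).le.trans hε.le⟩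
  have e2 := h2.isElementary fun b ε hε => ⟨g b, (hg b).le.trans hε.le⟩
  refine ⟨P, fun φ hφ hs v w => ?_, fun φ hφ hs v w => ?_⟩
  · rw [← e1 φ hφ w]
    exact P.val_sentence hs _ _
  · rw [← e2 φ hφ v]
    exact N.val_sentence hs _ _

/-! ### Back-and-forth construction -/

/-- Two structures and an `L`-elementary map between them. -/
structure Pair (L : Language S) where
  left : PreStructure S
  right : PreStructure S
  map : left.carrier → right.carrier
  isElementary : IsElementary L left right map

theorem IsElementary.isPartialElementary {L : Language S} {M N : PreStructure S}
    {f : M.carrier → N.carrier} (hf : IsElementary L M N f) :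
    IsPartialElementary L M N fun a b => f a = b := fun φ hφ v w h => by
  rw [← hf φ hφ v]
  exact N.val_congr φ h

/-- Two amalgamations: the first extends the left side so that `g` inverts `A.map`, the second
extends the right side so that the new map inverts `g`, everything up to distance zero. -/
theorem Pair.exists_next {L : Language S} (A : Pair L) :
    ∃ (B : Pair L) (e : A.left.carrier → B.left.carrier)
      (e' : A.right.carrier → B.right.carrier) (g : A.right.carrier → B.left.carrier),
      IsElementary (Language.all S) _ _ e ∧ IsElementary (Language.all S) _ _ e' ∧
      (∀ a, B.right.d (B.map (e a)) (e' (A.map a)) = 0) ∧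
      ∀ b, B.right.d (B.map (g b)) (e' b) = 0 := by
  obtain ⟨M, e, g, he, hg, h⟩ := A.isElementary.isPartialElementary.exists_amalgam
  obtain ⟨N, e', f, he', hf, h'⟩ := hg.isPartialElementary.exists_amalgam
  refine ⟨⟨M, N, f, hf⟩, e, e', g, he, he', fun a => ?_, fun b => h' b _ rfl⟩
  refine N.d_zero_trans (hf.isMorphism.d_map_zero ?_) (h' (A.map a) _ rfl)
  rw [d_comm]
  exact h a _ rfl

/-- Structures with the same values of the `L₁ ∩ L₂`-sentences have a common amalgam. -/
theorem exists_amalgam_of_equiv {L₁ L₂ : Language S} {M N : PreStructure S}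
    (h : ∀ φ : Formula S, φ.In (L₁ ∩ L₂) → φ.IsSentence → ∀ v w, M.val φ v = N.val φ w) :
    ∃ P : PreStructure S,
      (∀ φ : Formula S, φ.In L₁ → φ.IsSentence → ∀ v w, P.val φ v = M.val φ w) ∧
      ∀ φ : Formula S, φ.In L₂ → φ.IsSentence → ∀ v w, P.val φ v = N.val φ w := by
  -- For the empty relation the condition only involves sentences. Amalgamating along it starts the
  -- chains: `N` is replaced by an elementary extension that receives `M`.
  have hE : IsPartialElementary (L₁ ∩ L₂) N M fun _ _ => False := fun φ hφ v w hvw =>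
    (h φ hφ (Set.eq_empty_of_forall_notMem hvw) w v).symm
  obtain ⟨N', i, f, hi, hf, -⟩ := hE.exists_amalgam
  choose next e e' g he he' hfe hfg using Pair.exists_next (L := L₁ ∩ L₂)
  let A : ℕ → Pair (L₁ ∩ L₂) := fun n => n.rec ⟨M, N', f, hf⟩ fun _ => next
  have he1 : ∀ n, IsElementary (Language.all S) (A n).left (A (n + 1)).left (e (A n)) :=
    fun n => he (A n)
  have he2 : ∀ n, IsElementary (Language.all S) (A n).right (A (n + 1)).right (e' (A n)) :=
    fun n => he' (A n)
  obtain ⟨P, h1, h2⟩ := exists_common_expansion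
    (isElementary_limitMap he1 he2 (f := fun n => (A n).map) (fun n => (A n).isElementary)
      fun n => hfe (A n))
    (exists_d_limitMap_eq_zero he1 he2 (g := fun n => g (A n)) fun n => hfg (A n))
  refine ⟨P, fun φ hφ hs v w => ?_, fun φ hφ hs v w => ?_⟩
  · rw [h1 φ hφ hs v (toLimit he1 0 ∘ w)]
    exact isElementary_toLimit he1 0 φ φ.in_all w
  · rw [h2 φ hφ hs v (toLimit he2 0 ∘ i ∘ w), ← hi φ φ.in_all w]
    exact isElementary_toLimit he2 0 φ φ.in_all (i ∘ w)

end PreStructure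

/-! ### Completion, and passage to and from `LStructure` -/

/-- Lipschitz maps on a finite power extend to the power of the completion. -/
theorem exists_lipschitz_extension {A Y : Type*} [PseudoMetricSpace A] [MetricSpace Y]
    [CompleteSpace Y] {n : ℕ} (h : (Fin n → A) → Y) (c : ℝ≥0)
    (hh : ∀ a b, dist (h a) (h b) ≤ c * ∑ i, dist (a i) (b i)) :
    ∃ H : (Fin n → UniformSpace.Completion A) → Y,
      (∀ a : Fin n → A, H (fun i => (a i : UniformSpace.Completion A)) = h a) ∧ Continuous H ∧
      ∀ a b, dist (H a) (H b) ≤ c * ∑ i, dist (a i) (b i) := by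
  let ι : (Fin n → A) → (Fin n → UniformSpace.Completion A) := fun a i => a i
  have hιd : DenseRange ι :=
    DenseRange.piMap fun _ => UniformSpace.Completion.denseRange_coe
  have hι : IsUniformInducing ι := by
    have : Isometry ι := Isometry.piMap _ fun _ => UniformSpace.Completion.coe_isometry
    exact this.isUniformInducing
  have hu : UniformContinuous h := by
    -- The product carries the supremum metric, and the sum of `n` distances is at most `n` times
    -- it.
    refine (LipschitzWith.of_dist_le_mul (K := c * n) fun a b => (hh a b).trans ?_).uniformContinuous
    rw [NNReal.coe_mul, mul_assoc]
    refine mul_le_mul_of_nonneg_left ?_ c.2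
    refine (Finset.sum_le_sum fun i _ => dist_le_pi_dist a b i).trans_eq ?_
    simp
  let H := (hι.isDenseInducing hιd).extend h
  have hHι : ∀ a, H (ι a) = h a := uniformly_extend_of_ind hι hιd hu
  have hHc : Continuous H := (uniformContinuous_uniformly_extend hι hιd hu).continuous
  refine ⟨H, hHι, hHc, fun a b => ?_⟩
  refine hιd.induction_on₂ (p := fun a b => dist (H a) (H b) ≤ c * ∑ i, dist (a i) (b i)) ?_ ?_ a b
  · refine isClosed_le (by fun_prop) (by fun_prop)
  · intro a b
    rw [hHι, hHι]
    simpa only [ι, UniformSpace.Completion.dist_eq] using hh a b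

namespace LStructure

/-- Extension of an `L`-structure to a structure for all symbols, with trivial interpretations of
the new symbols. -/
@[reducible] noncomputable def toPre {L : Language S} (M : LStructure L) : PreStructure S :=
  open Classical in
  { carrier := M.carrier
    d := dist
    d_self := dist_self
    d_comm := dist_comm
    d_triangle := dist_triangle
    d_le_one := M.dist_le_one
    const := fun c => if h : c ∈ L.consts then M.const ⟨c, h⟩ else Classical.arbitrary _
    func := fun F a => if h : F ∈ L.funcs then M.func ⟨F, h⟩ a else Classical.arbitrary _
    func_lipschitz := fun F a b => by
      by_cases h : F ∈ L.funcs
      · simpa only [dif_pos h] using M.func_lipschitz ⟨F, h⟩ a b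
      · simp only [dif_neg h, dist_self]
        exact mul_nonneg (NNReal.coe_nonneg _) (Finset.sum_nonneg fun i _ => dist_nonneg)
    rel := fun R a => if h : R ∈ L.rels then M.rel ⟨R, h⟩ a else 0
    rel_mem := fun R a => by
      by_cases h : R ∈ L.rels
      · simpa only [dif_pos h] using M.rel_mem ⟨R, h⟩ a
      · simp [dif_neg h]
    rel_lipschitz := fun R a b => by
      by_cases h : R ∈ L.rels
      · simpa only [dif_pos h] using M.rel_lipschitz ⟨R, h⟩ a b
      · simp only [dif_neg h, sub_self]
        exact mul_nonneg (NNReal.coe_nonneg _) (Finset.sum_nonneg fun i _ => dist_nonneg) }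

theorem tval_toPre {L : Language S} (M : LStructure L) (v : ℕ → M.carrier) (t : Term S)
    (ht : t.In L) : M.toPre.tval v t = t.eval M v ht := by
  induction t with
  | var x => rfl
  | const c => exact dif_pos ht
  | func F ts ih =>
    refine (dif_pos ht.1).trans ?_
    rw [Term.eval]
    congr 1
    ext i
    exact ih i (ht.2 i)

theorem val_toPre {L : Language S} (M : LStructure L) (φ : Formula S) (hφ : φ.In L)
    (v : ℕ → M.carrier) : M.toPre.val φ v = φ.eval M hφ v := by
  induction φ generalizing v with
  | one => rfl
  | dist t₁ t₂ =>
    exact congrArg₂ (dist (α := M.carrier)) (M.tval_toPre v t₁ hφ.1) (M.tval_toPre v t₂ hφ.2)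
  | rel R ts =>
    refine (dif_pos hφ.1).trans ?_
    rw [Formula.eval]
    congr 1
    ext i
    exact M.tval_toPre v (ts i) (hφ.2 i)
  | add φ ψ h h' => exact congrArg₂ (· + ·) (h hφ.1 v) (h' hφ.2 v)
  | smul r φ h => exact congrArg (r * ·) (h hφ v)
  | inf x φ h => exact iInf_congr fun b => h hφ _
  | sup x φ h => exact iSup_congr fun b => h hφ _

/-- The reduct to a smaller language. -/
@[reducible] def reduct {L L' : Language S} (M : LStructure L) (hc : L'.consts ⊆ L.consts)
    (hf : L'.funcs ⊆ L.funcs) (hr : L'.rels ⊆ L.rels) : LStructure L' where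
  carrier := M.carrier
  dist_le_one := M.dist_le_one
  const c := M.const ⟨c, hc c.2⟩
  func F := M.func ⟨F, hf F.2⟩
  func_lipschitz F := M.func_lipschitz ⟨F, hf F.2⟩
  rel R := M.rel ⟨R, hr R.2⟩
  rel_mem R := M.rel_mem ⟨R, hr R.2⟩
  rel_lipschitz R := M.rel_lipschitz ⟨R, hr R.2⟩

theorem eval_reduct_term {L L' : Language S} (M : LStructure L) (hc : L'.consts ⊆ L.consts)
    (hf : L'.funcs ⊆ L.funcs) (hr : L'.rels ⊆ L.rels) (v : ℕ → M.carrier) (t : Term S)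
    (h' : t.In L') (h : t.In L) : t.eval (M.reduct hc hf hr) v h' = t.eval M v h := by
  induction t with
  | var x => rfl
  | const c => rfl
  | func F ts ih =>
    exact congrArg (M.func ⟨F, h.1⟩) (funext fun i => ih i (h'.2 i) (h.2 i))

theorem eval_reduct {L L' : Language S} (M : LStructure L) (hc : L'.consts ⊆ L.consts)
    (hf : L'.funcs ⊆ L.funcs) (hr : L'.rels ⊆ L.rels) (φ : Formula S) (h' : φ.In L')
    (h : φ.In L) (v : ℕ → M.carrier) : φ.eval (M.reduct hc hf hr) h' v = φ.eval M h v := by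
  induction φ generalizing v with
  | one => rfl
  | dist t₁ t₂ =>
    exact congrArg₂ (dist (α := M.carrier)) (M.eval_reduct_term hc hf hr v t₁ h'.1 h.1)
      (M.eval_reduct_term hc hf hr v t₂ h'.2 h.2)
  | rel R ts =>
    exact congrArg (M.rel ⟨R, h.1⟩)
      (funext fun i => M.eval_reduct_term hc hf hr v (ts i) (h'.2 i) (h.2 i))
  | add φ ψ i i' => exact congrArg₂ (· + ·) (i h'.1 h.1 v) (i' h'.2 h.2 v)
  | smul r φ i => exact congrArg (r * ·) (i h' h v)
  | inf x φ i => exact iInf_congr fun b => i h' h _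
  | sup x φ i => exact iSup_congr fun b => i h' h _

end LStructure

namespace PreStructure

/-- The completion of a structure is an `L`-structure with the same values of `L`-sentences. -/
theorem exists_completion (P : PreStructure S) (L : Language S) :
    ∃ M : LStructure L, ∀ (φ : Formula S) (hφ : φ.In L), φ.IsSentence →
      ∀ v w, φ.eval M hφ v = P.val φ w := by
  let _ : PseudoMetricSpace P.carrier :=
    { dist := P.d
      dist_self := P.d_self
      dist_comm := P.d_comm
      dist_triangle := P.d_triangle }
  choose f hf _ hflip using fun F : S.Func => exists_lipschitz_extension
    (fun a => ((P.func F a : P.carrier) : UniformSpace.Completion P.carrier)) (S.funcLip F)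
    fun a b => by rw [UniformSpace.Completion.dist_eq]; exact P.func_lipschitz F a b
  choose r hr hrc hrlip using fun R : S.Rel => exists_lipschitz_extension (P.rel R) (S.relLip R)
    fun a b => P.abs_rel_sub_rel_le R a b
  have hd : ∀ a b : UniformSpace.Completion P.carrier, dist a b ≤ 1 := by
    intro a b
    refine UniformSpace.Completion.induction_on₂ a b (isClosed_le (by fun_prop) (by fun_prop)) ?_
    intro a b
    rw [UniformSpace.Completion.dist_eq]
    exact P.d_le_one a b
  let M : LStructure L :=
    { carrier := UniformSpace.Completion P.carrier
      nonempty := ⟨(Classical.arbitrary P.carrier : P.carrier)⟩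
      dist_le_one := hd
      const := fun c => (P.const c : UniformSpace.Completion P.carrier)
      func := fun F => f F
      func_lipschitz := fun F => hflip F
      rel := fun R => r R
      rel_mem := fun R a => by
        have hden : DenseRange fun (a : Fin (S.relArity R) → P.carrier) i =>
            (a i : UniformSpace.Completion P.carrier) :=
          DenseRange.piMap fun _ => UniformSpace.Completion.denseRange_coe
        refine hden.induction_on (p := fun a => r R a ∈ Set.Icc (0 : ℝ) 1) a
          (isClosed_Icc.preimage (hrc R)) fun b => ?_
        rw [hr]
        exact P.rel_mem R b
      rel_lipschitz := fun R a b => (le_abs_self _).trans (hrlip R a b) }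
  have hι : IsMorphism L P M.toPre fun a => (a : UniformSpace.Completion P.carrier) :=
    { d_map := fun a b => UniformSpace.Completion.dist_eq a b
      map_const := fun c hc =>
        (congrArg (M.toPre.d _) (dif_pos hc)).trans (M.toPre.d_self _)
      map_func := fun F hF a =>
        (congrArg (M.toPre.d _) ((dif_pos hF).trans (hf F a))).trans (M.toPre.d_self _)
      map_rel := fun R hR a => (dif_pos hR).trans (hr R a) }
  -- The canonical map into the completion preserves the symbols and has dense range, hence it is
  -- elementary.
  have he := hι.isElementary fun b ε hε => by
    obtain ⟨a, ha⟩ := (UniformSpace.Completion.denseRange_coe (α := P.carrier)).exists_dist_lt b hε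
    exact ⟨a, (dist_comm _ _).trans_le ha.le⟩
  refine ⟨M, fun φ hφ hs v w => ?_⟩
  rw [← M.val_toPre, ← he φ hφ w]
  exact M.toPre.val_sentence hs _ _

end PreStructure

/-! ### Change of language -/

theorem Term.In.mono {L L' : Language S} (hc : L.consts ⊆ L'.consts) (hf : L.funcs ⊆ L'.funcs)
    {t : Term S} (h : t.In L) : t.In L' := by
  induction t with
  | var x => trivial
  | const c => exact hc h
  | func F ts ih => exact ⟨hf h.1, fun i => ih i (h.2 i)⟩

theorem Formula.In.mono {L L' : Language S} (hc : L.consts ⊆ L'.consts)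
    (hf : L.funcs ⊆ L'.funcs) (hr : L.rels ⊆ L'.rels) {φ : Formula S} (h : φ.In L) :
    φ.In L' := by
  induction φ with
  | one => trivial
  | dist t₁ t₂ => exact ⟨h.1.mono hc hf, h.2.mono hc hf⟩
  | rel R ts => exact ⟨hr h.1, fun i => (h.2 i).mono hc hf⟩
  | add φ ψ i i' => exact ⟨i h.1, i' h.2⟩
  | smul r φ i => exact i h
  | inf x φ i => exact i h
  | sup x φ i => exact i h

/-- The values of the sentences decided by a theory are the same in all structures for larger
languages that model the theory. -/
theorem exists_val_toPre_eq {L₀ : Language S} {T₀ : Set (Condition S)}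
    (hT₀ : ∀ c ∈ T₀, c.In L₀)
    {φ : Formula S} (hφ : φ.In L₀)
    (hd : ∃ r : ℝ, Entails L₀ T₀ ⟨φ, Formula.real r⟩ ∧ Entails L₀ T₀ ⟨Formula.real r, φ⟩) :
    ∃ r : ℝ, ∀ (L : Language S) (M : LStructure L), L₀.consts ⊆ L.consts → L₀.funcs ⊆ L.funcs →
      L₀.rels ⊆ L.rels → M.ModelsTheory T₀ → ∀ v, M.toPre.val φ v = r := by
  obtain ⟨r, h1, h2⟩ := hd
  refine ⟨r, fun L M hc hf hr hM v => ?_⟩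
  -- Entailment over `L₀` quantifies over `L₀`-structures only, so it is applied to the reduct.
  have hM₀ : (M.reduct hc hf hr).ModelsTheory T₀ := fun c hcT => by
    obtain ⟨hcL, h⟩ := hM c hcT
    refine ⟨hT₀ c hcT, fun v => ?_⟩
    rw [M.eval_reduct hc hf hr _ _ hcL.1, M.eval_reduct hc hf hr _ _ hcL.2]
    exact h v
  have hφL := hφ.mono hc hf hr
  rw [M.val_toPre φ hφL, ← M.eval_reduct hc hf hr φ hφ]
  obtain ⟨_, h1⟩ := h1 _ hM₀
  obtain ⟨_, h2⟩ := h2 _ hM₀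
  refine le_antisymm ((h1 v).trans_eq (mul_one r)) ((mul_one r).symm.trans_le (h2 v))

/-- A model of a theory in which the sentences of the language have the same values as in a given
model of the theory. -/
theorem models_of_eval_eq {L L' : Language S} (hc : L.consts ⊆ L'.consts)
    (hf : L.funcs ⊆ L'.funcs) (hr : L.rels ⊆ L'.rels) {T : Set (Condition S)}
    (hT : IsTheory L T) {M : LStructure L} (hM : M.ModelsTheory T) {K : LStructure L'}
    (h : ∀ (φ : Formula S) (_ : φ.In L) (hφ : φ.In L'), φ.IsSentence →
      ∀ v w, φ.eval K hφ v = M.toPre.val φ w) : K.ModelsTheory T := by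
  intro c hcT
  obtain ⟨⟨i1, i2⟩, s1, s2⟩ := hT c hcT
  obtain ⟨_, hle⟩ := hM c hcT
  refine ⟨⟨i1.mono hc hf hr, i2.mono hc hf hr⟩, fun v => ?_⟩
  let w : ℕ → M.carrier := fun _ => Classical.arbitrary _
  rw [h _ i1 _ s1 v w, h _ i2 _ s2 v w, M.val_toPre _ i1, M.val_toPre _ i2]
  exact hle w

end AffineLogic

/-! ### Robinson's consistency theorem -/

theorem mainTheorem10 {S : AffineLogic.Symbols.{u}} (L₁ L₂ : AffineLogic.Language S)
    (T₁ T₂ : Set (AffineLogic.Condition S))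
    (hT₁ : AffineLogic.IsTheory L₁ T₁) (hT₂ : AffineLogic.IsTheory L₂ T₂)
    (hs₁ : AffineLogic.Satisfiable L₁ T₁) (hs₂ : AffineLogic.Satisfiable L₂ T₂)
    (hc : AffineLogic.IsComplete (L₁ ∩ L₂) (T₁ ∩ T₂)) :
    AffineLogic.Satisfiable (L₁ ∪ L₂) (T₁ ∪ T₂) := by
  obtain ⟨M, hM⟩ := hs₁
  obtain ⟨N, hN⟩ := hs₂
  -- Being a model of a condition includes that the condition lies in the language, so the model
  -- supplied by completeness yields this.
  have hIn : ∀ c ∈ T₁ ∩ T₂, c.In (L₁ ∩ L₂) := by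
    obtain ⟨⟨K, hK⟩, -⟩ := hc
    exact fun c h => (hK c h).1
  obtain ⟨P, h1, h2⟩ := AffineLogic.PreStructure.exists_amalgam_of_equiv (L₁ := L₁) (L₂ := L₂)
    (M := M.toPre) (N := N.toPre) fun φ hφ hs v w => by
      obtain ⟨r, hr⟩ := AffineLogic.exists_val_toPre_eq hIn hφ (hc.2 φ hφ hs)
      rw [hr L₁ M Set.inter_subset_left Set.inter_subset_left Set.inter_subset_left
          (fun c h => hM c h.1) v,
        hr L₂ N Set.inter_subset_right Set.inter_subset_right Set.inter_subset_right
          (fun c h => hN c h.2) w]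
  obtain ⟨K, hK⟩ := P.exists_completion (L₁ ∪ L₂)
  have hK1 : K.ModelsTheory T₁ := AffineLogic.models_of_eval_eq Set.subset_union_left
    Set.subset_union_left Set.subset_union_left hT₁ hM fun φ i hφ hs v w =>
      (hK φ hφ hs v fun _ => Classical.arbitrary _).trans (h1 φ i hs _ w)
  have hK2 : K.ModelsTheory T₂ := AffineLogic.models_of_eval_eq Set.subset_union_right
    Set.subset_union_right Set.subset_union_right hT₂ hN fun φ i hφ hs v w =>
      (hK φ hφ hs v fun _ => Classical.arbitrary _).trans (h2 φ i hs _ w)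
  exact ⟨K, fun c h => h.elim (hK1 c) (hK2 c)⟩
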